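/- **Setting.** Let $N,L\in\mathbb N$. For each system $n\in\{1,\dots,N\}$ let $\mathcal A^n$ be a measurable set of actions. Each system operates on the slots $t=0,1,2,\dots$, which are segmented into back-to-back frames; the $k$-th frame of system $n$ occupies the slots $\mathcal T^n_k=\{t^n_k,\dots,t^n_{k+1}-1\}$, where $t^n_0=0$ and $T^n_k=t^n_{k+1}-t^n_k\ge 1$. At slot $t^n_k$ an action $\alpha^n_k\in\mathcal A^n$ (possibly random) is chosen. In slot $t$ system $n$ incurs a penalty $y^n[t]\in\mathbb R$ and a metric vector $\mathbf z^n[t]\in\mathbb R^L$, and an external vector $\mathbf d[t]\in\mathbb R^L$ is observed. Let $\mathcal F[t]$ be the $\sigma$-algebra of the information of all systems from slots $0,\dots,t-1$ (penalties, metrics, external process, actions, and the renewals up to slot $t$). *Renewal property.* For each $n$ there is a fixed measurable family of probability laws $\kappa^n(\alpha)$, $\alpha\in\mathcal A^n$, such that given $\alpha^n_k=\alpha$ the frame outcome $(T^n_k,(y^n[t],\mathbf z^n[t])_{t\in\mathcal T^n_k})$ is independent of the history of all systems before $t^n_k$ and has law $\kappa^n(\alpha)$. *External process.* $\{\mathbf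 d[t]\}$ is i.i.d. with a fixed law, $\mathbf d[t]$ is independent of $\mathcal F[t]$, and $d_l:=\mathbb E[d_l[t]]$. Consider the problem $$\min\ \limsup_{T\to\infty}\frac1T\sum_{t=0}^{T-1}\sum_{n=1}^N\mathbb E[y^n[t]]\quad\text{s.t.}\quad \limsup_{T\to\infty}\frac1T\sum_{t=0}^{T-1}\sum_{n=1}^N\mathbb E[z^n_l[t]]\le d_l,\ \ l=1,\dots,L, \qquad(*)$$ over all ways of choosing the actions, and let $f_*$ be its infimum. For $\alpha\in\mathcal A^n$ let $\widehat y^n(\alpha),\widehat z^n_l(\alpha),\widehat T^n(\alpha)$ be the expectations under $\kappa^n(\alpha)$ of the total penalty, of the total $l$-th metric, and of the duration of a frame, and let $\widehat f^n=\widehat y^n/\widehat T^n$, $\widehat g^n_l=\widehat z^n_l/\widehat T^n$. **Assumptions.** (i) Problem $(*)$ is feasible. (ii) There are constants $y_{\max},z_{\max},d_{\max}$ with $|y^n[t]|\le y_{\max}$, $|z^n_l[t]|\le z_{\max}$, $|d_l[t]|\le d_{\max}$ almost surely (under all actions), and a constant $B\ge1$ such that $\mathbb E[(T^n_k-s)^2\mid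 \alpha^n_k=\alpha,\,T^n_k\ge s]\le B$ for all $n$, $\alpha\in\mathcal A^n$ and $s\in\mathbb N$ with $\Pr(T^n_k\ge s\mid\alpha^n_k=\alpha)>0$. (iii) For each $n$ the set $\{(\widehat f^n(\alpha),\widehat{\mathbf g}^n(\alpha)):\alpha\in\mathcal A^n\}\subseteq\mathbb R^{L+1}$ is compact. **Algorithm.** Fix $V>0$. Let $Q_l[0]=0$ and $Q_l[t+1]=\max\{Q_l[t]+\sum_{n=1}^N z^n_l[t]-d_l[t],0\}$ after each slot. At the start of its $k$-th frame, each system $n$ observes $\mathbf Q[t^n_k]$ and chooses an $\alpha^n_k\in\mathcal A^n$ that minimizes over $\alpha\in\mathcal A^n$ the ratio $$\frac{\mathbb E\big[\sum_{t\in\mathcal T^n_k}\big(V y^n[t]+\langle \mathbf Q[t^n_k],\mathbf z^n[t]\rangle\big)\,\big|\,\alpha^n_k=\alpha,\ \mathbf Q[t^n_k]\big]}{\mathbb E\big[T^n_k\,\big|\,\alpha^n_k=\alpha,\ \mathbf Q[t^n_k]\big]} .$$ **Theorem.** Under these assumptions, any sequences $\{y^n[t]\}$, $\{\mathbf z^n[t]\}$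 produced by the algorithm satisfy all the constraints in $(*)$, and $$\limsup_{T\to\infty}\frac1T\sum_{t=0}^{T-1}\sum_{n=1}^N\mathbb E[y^n[t]]\le f_*+\frac{NC_1+C_3}{V},\qquad C_1=6Lz_{\max}(Nz_{\max}+d_{\max})B,\quad C_3=\frac{(Nz_{\max}+d_{\max})^2L}{2}.$$ -/

import Mathlib

open MeasureTheory ProbabilityTheory Filter Finset
open scoped BigOperators ENNReal

universe u v

/-- The outcome of one renewal frame: its duration `T ≥ 1` and, for each of its `T` slots, the
penalty and the vector of `L` performance metrics incurred in that slot. -/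
abbrev Frame (L : ℕ) : Type := (T : ℕ+) × (Fin (T : ℕ) → ℝ × (Fin L → ℝ))

namespace Frame

variable {L : ℕ}

/-- The duration of the frame. -/
def duration (o : Frame L) : ℕ := (o.1 : ℕ)

/-- The penalty accumulated over the frame. -/
noncomputable def totalPenalty (o : Frame L) : ℝ := ∑ j, (o.2 j).1

/-- The `l`-th performance metric accumulated over the frame. -/
noncomputable def totalMetric (o : Frame L) (l : Fin L) : ℝ := ∑ j, (o.2 j).2 l

end Frame

section Performance

variable {A : Type u} [MeasurableSpace A] {L : ℕ}

/-- Expected duration of a frame started with action `a`, where `κ a` is the law of the frame. -/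
noncomputable def expDuration (κ : Kernel A (Frame L)) (a : A) : ℝ :=
  ∫ o, (o.duration : ℝ) ∂(κ a)

/-- Expected penalty accumulated over a frame started with action `a`. -/
noncomputable def expPenalty (κ : Kernel A (Frame L)) (a : A) : ℝ :=
  ∫ o, o.totalPenalty ∂(κ a)

/-- Expected `l`-th performance metric accumulated over a frame started with action `a`. -/
noncomputable def expMetric (κ : Kernel A (Frame L)) (a : A) (l : Fin L) : ℝ :=
  ∫ o, o.totalMetric l ∂(κ a)

/-- The performance vector `(f̂(a), ĝ(a))` of an action: expected penalty per expected slot and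
expected metrics per expected slot. -/
noncomputable def performanceVector (κ : Kernel A (Frame L)) (a : A) : ℝ × (Fin L → ℝ) :=
  (expPenalty κ a / expDuration κ a, fun l => expMetric κ a l / expDuration κ a)

/-- The drift-plus-penalty ratio of action `a` when the vector of virtual queues is `q`: the
expectation of `∑ (V y[t] + ⟨q, z[t]⟩)` over the slots of the frame, divided by the expected
duration of the frame. -/
noncomputable def dppRatio (κ : Kernel A (Frame L)) (V : ℝ) (q : Fin L → ℝ) (a : A) : ℝ :=
  (∫ o, ∑ j, (V * (o.2 j).1 + ∑ l, q l * (o.2 j).2 l) ∂(κ a)) / expDuration κ a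

end Performance

/-- The random variables of `N` renewal systems run in parallel on a slotted timeline
`t = 0, 1, 2, …`, system `n` having action set `A n`. -/
structure Run {N : ℕ} (A : Fin N → Type u) (L : ℕ) (Ω : Type v) where
  /-- `duration n k` is the duration of the `k`-th frame of system `n`. -/
  duration : Fin N → ℕ → Ω → ℕ+
  /-- `action n k` is the decision taken at the start of the `k`-th frame of system `n`. -/
  action : (n : Fin N) → ℕ → Ω → A n
  /-- `y n t` is the penalty of system `n` in slot `t`. -/
  y : Fin N → ℕ → Ω → ℝ
  /-- `z n t` is the vector of performance metrics of system `n` in slot `t`. -/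
  z : Fin N → ℕ → Ω → (Fin L → ℝ)
  /-- `d t` is the value of the external process in slot `t`. -/
  d : ℕ → Ω → (Fin L → ℝ)

namespace Run

variable {N : ℕ} {A : Fin N → Type u} {L : ℕ} {Ω : Type v}

/-- The slot in which the `k`-th frame of system `n` starts (the `k`-th renewal time). -/
def start (X : Run A L Ω) (n : Fin N) (k : ℕ) (ω : Ω) : ℕ :=
  ∑ i ∈ range k, (X.duration n i ω : ℕ)

/-- The outcome of the `k`-th frame of system `n`. -/
def frame (X : Run A L Ω) (n : Fin N) (k : ℕ) (ω : Ω) : Frame L :=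
  ⟨X.duration n k ω,
    fun j => (X.y n (X.start n k ω + j) ω, X.z n (X.start n k ω + j) ω)⟩

/-- The information of all systems from the slots `0, …, t - 1`: penalties, metrics and external
process in these slots, the decisions taken in them, and the renewals up to slot `t` (a renewal in
slot `s` says that a frame has ended in slot `s - 1`). In particular it is trivial for `t = 0`. -/
abbrev history [∀ n, MeasurableSpace (A n)] (X : Run A L Ω) (t : ℕ) : MeasurableSpace Ω :=
  (⨆ (n : Fin N) (s : ℕ) (_ : s < t), MeasurableSpace.comap (X.y n s) inferInstance) ⊔
  (⨆ (n : Fin N) (s : ℕ) (_ : s < t), MeasurableSpace.comap (X.z n s) inferInstance) ⊔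
  (⨆ (s : ℕ) (_ : s < t), MeasurableSpace.comap (X.d s) inferInstance) ⊔
  MeasurableSpace.generateFrom
    {E | ∃ (n : Fin N) (k s : ℕ), s ≤ t ∧ E = {ω | X.start n k ω = s}} ⊔
  MeasurableSpace.generateFrom
    {E | ∃ (n : Fin N) (k s : ℕ) (D : Set (A n)), s < t ∧ MeasurableSet D ∧
      E = {ω | X.start n k ω = s ∧ X.action n k ω ∈ D}}

/-- The run `X` on the probability space `(Ω, P)` is a run of the renewal systems with frame laws
`κ n` and external law `ν`, under some (arbitrary, possibly randomized and history dependent) way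
of taking the decisions. -/
structure IsRunOf [∀ n, MeasurableSpace (A n)] [MeasurableSpace Ω] (X : Run A L Ω)
    (P : Measure Ω) (κ : (n : Fin N) → Kernel (A n) (Frame L)) (ν : Measure (Fin L → ℝ)) :
    Prop where
  measurable_duration : ∀ n k, Measurable (fun ω => (X.duration n k ω : ℕ))
  measurable_action : ∀ n k, Measurable (X.action n k)
  measurable_y : ∀ n t, Measurable (X.y n t)
  measurable_z : ∀ n t, Measurable (X.z n t)
  measurable_d : ∀ t, Measurable (X.d t)
  /-- Renewal property: given the decision, the outcome of a frame is independent of the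
  information of all systems from the slots before the frame, and its conditional law is the
  frame law of the decision. -/
  renewal : ∀ (n : Fin N) (k t : ℕ) (H : Set Ω) (D : Set (A n)) (S : Set (Frame L)),
    MeasurableSet[X.history t] H → MeasurableSet D → MeasurableSet S →
    P (H ∩ {ω | X.start n k ω = t} ∩ {ω | X.action n k ω ∈ D} ∩ {ω | X.frame n k ω ∈ S}) =
      ∫⁻ ω in H ∩ {ω | X.start n k ω = t} ∩ {ω | X.action n k ω ∈ D},
        κ n (X.action n k ω) S ∂P
  /-- The external process is i.i.d. with law `ν` and uncontrollable: its value in slot `t` has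
  law `ν` and is independent of the information from the slots before (which contains the
  earlier values). -/
  law_d : ∀ t, P.map (X.d t) = ν
  indep_d : ∀ t, Indep (MeasurableSpace.comap (X.d t) inferInstance) (X.history t) P

/-- `limsup_{T → ∞} (1/T) ∑_{t<T} ∑_n E[y^n[t]]`. -/
noncomputable def longRunPenalty [MeasurableSpace Ω] (X : Run A L Ω) (P : Measure Ω) : ℝ :=
  limsup (fun T : ℕ => (1 / (T : ℝ)) * ∑ t ∈ range T, ∑ n, ∫ ω, X.y n t ω ∂P) atTop

/-- `limsup_{T → ∞} (1/T) ∑_{t<T} ∑_n E[z^n_l[t]]`. -/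
noncomputable def longRunMetric [MeasurableSpace Ω] (X : Run A L Ω) (P : Measure Ω)
    (l : Fin L) : ℝ :=
  limsup (fun T : ℕ => (1 / (T : ℝ)) * ∑ t ∈ range T, ∑ n, ∫ ω, X.z n t ω l ∂P) atTop

/-- The time average constraints: each long run metric is at most the mean of the corresponding
component of the external process. -/
def SatisfiesConstraints [MeasurableSpace Ω] (X : Run A L Ω) (P : Measure Ω)
    (ν : Measure (Fin L → ℝ)) : Prop :=
  ∀ l, X.longRunMetric P l ≤ ∫ x, x l ∂ν

/-- The virtual queues: `Q[0] = 0` and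
`Q_l[t+1] = max {Q_l[t] + ∑_n z^n_l[t] - d_l[t], 0}`. -/
noncomputable def queue (X : Run A L Ω) (ω : Ω) : ℕ → Fin L → ℝ
  | 0 => fun _ => 0
  | t + 1 => fun l => max (X.queue ω t l + ∑ n, X.z n t ω l - X.d t ω l) 0

/-- The decisions of the run are those of the proposed algorithm with trade-off parameter `V`: at
the start of each frame, the system picks an action which minimizes the drift-plus-penalty ratio
for the current vector of virtual queues. -/
def FollowsAlgorithm [∀ n, MeasurableSpace (A n)] [MeasurableSpace Ω] (X : Run A L Ω)
    (P : Measure Ω) (κ : (n : Fin N) → Kernel (A n) (Frame L)) (V : ℝ) : Prop :=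
  ∀ n k, ∀ᵐ ω ∂P, ∀ a : A n,
    dppRatio (κ n) V (X.queue ω (X.start n k ω)) (X.action n k ω) ≤
      dppRatio (κ n) V (X.queue ω (X.start n k ω)) a

end Run

section Optimum

variable {N : ℕ} {A : Fin N → Type u} [∀ n, MeasurableSpace (A n)] {L : ℕ}

/-- The objective values of all runs (on all probability spaces) that satisfy the constraints. -/
def feasibleValues (κ : (n : Fin N) → Kernel (A n) (Frame L)) (ν : Measure (Fin L → ℝ)) : Set ℝ :=
  {r | ∃ (Ω : Type u) (_ : MeasurableSpace Ω) (P : Measure Ω) (X : Run A L Ω),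
    IsProbabilityMeasure P ∧ X.IsRunOf P κ ν ∧ X.SatisfiesConstraints P ν ∧
      r = X.longRunPenalty P}

/-- The infimum of the objective over all runs that satisfy the constraints. -/
noncomputable def optimalValue (κ : (n : Fin N) → Kernel (A n) (Frame L))
    (ν : Measure (Fin L → ℝ)) : ℝ :=
  sInf (feasibleValues κ ν)

end Optimum

/-! The proof is a Lyapunov drift argument, carried out frame by frame within each system because
the systems renew asynchronously. Squaring the queue recursion bounds the one-slot growth of half
the squared queue norm by `⟨Q, ∑ z - d⟩` plus a constant. Since `d[t]` is independent of the past,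
adding `V` times the penalty reduces everything to bounding, for each system, the expected sum of `V
(y - f) + ⟨Q[t], z - g⟩` against a fixed benchmark `(f, g)`.

The benchmark comes from an arbitrary feasible run (`exists_benchmark`). Its expected time averages,
system by system, are bounded and so converge along a subsequence. A linear functional that is at
least `c` at the performance vectors of all actions is at least `c` at the limit, because whole
frames satisfy this in expectation and the overshoot of the last frame is bounded. These
inequalities replace a stationary randomized policy: the algorithm minimizes exactly such a
functional, with weights `(V, Q)` frozen at the start of the frame, so its ratio is at most `V f +
⟨Q, g⟩`.

Two errors remain, both controlled in `integral_sum_le`. Within a frame the queue has drifted by at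
most `(N zmax + dmax) j` after `j` slots, which costs a multiple of the squared duration, of mean at
most `B`. The frame crossing the horizon `T` is cut off; its missing part has cost of order `T` per
slot, but only one frame crosses and its expected residual is at most `B`. Both errors grow linearly
in `T`.

Hence `E Q[T]²` grows at most linearly, so `E Q[T] / T` tends to `0`, which gives the constraints
because `Q[T]` dominates the accumulated violation. Discarding the queue term and dividing by `V T`
bounds the penalty by that of any feasible run plus the constant over `V`; then pass to the infimum.
-/

namespace Frame

variable {L : ℕ}

/-! ### Measurability on the space of frames -/

theorem measurable_of_comp_mk {γ : Type*} [MeasurableSpace γ] {f : Frame L → γ}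
    (h : ∀ T : ℕ+, Measurable fun x : Fin (T : ℕ) → ℝ × (Fin L → ℝ) => f ⟨T, x⟩) :
    Measurable f := by
  intro s hs
  exact MeasurableSpace.measurableSet_iInf.2 fun T => h T hs

theorem measurable_mk (T : ℕ+) :
    Measurable fun x : Fin (T : ℕ) → ℝ × (Fin L → ℝ) => (⟨T, x⟩ : Frame L) :=
  fun _ hs => MeasurableSpace.measurableSet_iInf.1 hs T

theorem measurable_duration : Measurable (duration : Frame L → ℕ) :=
  measurable_of_comp_mk fun T => measurable_const (a := (T : ℕ))

theorem measurable_totalPenalty : Measurable (totalPenalty : Frame L → ℝ) :=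
  measurable_of_comp_mk fun T => by
    change Measurable fun x : Fin (T : ℕ) → ℝ × (Fin L → ℝ) => ∑ j, (x j).1
    fun_prop

theorem measurable_totalMetric (l : Fin L) :
    Measurable fun o : Frame L => o.totalMetric l :=
  measurable_of_comp_mk fun T => by
    change Measurable fun x : Fin (T : ℕ) → ℝ × (Fin L → ℝ) => ∑ j, (x j).2 l
    fun_prop

theorem measurableSet_le_duration (m : ℕ) : MeasurableSet {o : Frame L | m ≤ o.duration} :=
  measurable_duration (measurableSet_Ici (a := m))

theorem measurableSet_forall_slot {p : ℝ × (Fin L → ℝ) → Prop} (hp : MeasurableSet {x | p x}) :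
    MeasurableSet {o : Frame L | ∀ j, p (o.2 j)} := by
  refine MeasurableSpace.measurableSet_iInf.2 fun T => ?_
  have : MeasurableSet (⋂ j : Fin (T : ℕ),
      {x : Fin (T : ℕ) → ℝ × (Fin L → ℝ) | p (x j)}) :=
    MeasurableSet.iInter fun j => measurable_pi_apply j hp
  have h : Sigma.mk T ⁻¹' {o : Frame L | ∀ j, p (o.2 j)} =
      ⋂ j : Fin (T : ℕ), {x : Fin (T : ℕ) → ℝ × (Fin L → ℝ) | p (x j)} := by
    ext x
    simp
  rw [← h] at this
  exact this

end Frame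

/-! ### Renewal times, histories and the law of a frame -/

namespace Run

variable {N : ℕ} {A : Fin N → Type u} {L : ℕ} {Ω : Type v} (X : Run A L Ω)

@[simp] theorem start_zero (n : Fin N) (ω : Ω) : X.start n 0 ω = 0 := by simp [start]

theorem start_succ (n : Fin N) (k : ℕ) (ω : Ω) :
    X.start n (k + 1) ω = X.start n k ω + X.duration n k ω := by
  simp [start, Finset.sum_range_succ]

theorem le_start (n : Fin N) (k : ℕ) (ω : Ω) : k ≤ X.start n k ω := by
  induction k with
  | zero => simp
  | succ k ih => rw [start_succ]; have := (X.duration n k ω).pos; omega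

theorem exists_slot_mem_frame (n : Fin N) (ω : Ω) (t : ℕ) :
    ∃ k j, j < (X.duration n k ω : ℕ) ∧ X.start n k ω + j = t := by
  induction t with
  | zero => exact ⟨0, 0, (X.duration n 0 ω).pos, by simp⟩
  | succ t ih =>
    obtain ⟨k, j, hj, rfl⟩ := ih
    by_cases h : j + 1 < X.duration n k ω
    · exact ⟨k, j + 1, h, by ring⟩
    · exact ⟨k + 1, 0, (X.duration n (k + 1) ω).pos, by rw [start_succ]; omega⟩

/-- Regrouping the slots before `T` according to the frames in which they lie. -/
theorem sum_range_eq_sum_frames (n : Fin N) (ω : Ω) (T : ℕ) (φ : ℕ → ℝ) :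
    ∑ t ∈ range T, φ t = ∑ k ∈ range T, ∑ s ∈ range T,
      if X.start n k ω = s then
        ∑ j ∈ range (X.duration n k ω), (if s + j < T then φ (s + j) else 0) else 0 := by
  set ψ : ℕ → ℝ := fun t => if t < T then φ t else 0
  have key : ∀ K, ∑ t ∈ range (X.start n K ω), ψ t =
      ∑ k ∈ range K, ∑ j ∈ range (X.duration n k ω), ψ (X.start n k ω + j) := by
    intro K
    induction K with
    | zero => simp
    | succ K ih => rw [start_succ, Finset.sum_range_add, ih, Finset.sum_range_succ]
  -- Every frame lasts at least one slot, so the first `T` frames already cover the slots before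
  -- `T`; the excess is killed by the cutoff in `ψ`.
  have h1 : ∑ t ∈ range T, φ t = ∑ t ∈ range (X.start n T ω), ψ t := by
    rw [← Finset.sum_subset (Finset.range_subset_range.2 (X.le_start n T ω))]
    · exact Finset.sum_congr rfl fun t ht => (if_pos (Finset.mem_range.1 ht)).symm
    · intro t _ ht
      exact if_neg (fun h => ht (Finset.mem_range.2 h))
  rw [h1, key]
  refine Finset.sum_congr rfl fun k _ => ?_
  rw [Finset.sum_ite_eq]
  split_ifs with h
  · rfl
  · refine Finset.sum_eq_zero fun j _ => ?_
    simp only [Finset.mem_range] at h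
    simp only [ψ]
    rw [if_neg (by omega)]

/-- Only one frame can reach or cross `T` after starting before it: renewal times increase, so the
indicators telescope. -/
theorem sum_indicator_residual_le_one (n : Fin N) (ω : Ω) (T K : ℕ) :
    ∑ k ∈ range K, (if X.start n k ω < T ∧ T ≤ X.start n (k + 1) ω then (1 : ℝ) else 0) ≤ 1 := by
  have : ∀ k, (if X.start n k ω < T ∧ T ≤ X.start n (k + 1) ω then (1 : ℝ) else 0) =
      (if X.start n k ω < T then (1 : ℝ) else 0) -
        (if X.start n (k + 1) ω < T then (1 : ℝ) else 0) := by
    intro k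
    have := X.start_succ n k ω
    split_ifs <;> first | (norm_num; done) | omega
  simp only [this]
  rw [Finset.sum_range_sub']
  split_ifs <;> norm_num

variable {X}

theorem measurable_queue {m : MeasurableSpace Ω} (T : ℕ)
    (hz : ∀ n, ∀ s < T, Measurable[m] (X.z n s)) (hd : ∀ s < T, Measurable[m] (X.d s)) :
    ∀ t ≤ T, Measurable[m] fun ω => X.queue ω t := by
  intro t
  induction t with
  | zero => intro _; exact measurable_const
  | succ t ih =>
    intro ht
    have h1 := ih (by omega)
    refine measurable_pi_iff.2 fun l => ?_
    simp only [queue]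
    refine Measurable.max ?_ measurable_const
    refine Measurable.sub (Measurable.add ((measurable_pi_apply l).comp h1) ?_)
      ((measurable_pi_apply l).comp (hd t (by omega)))
    exact Finset.measurable_sum _ fun n _ => (measurable_pi_apply l).comp (hz n t (by omega))

variable [∀ n, MeasurableSpace (A n)]

section Adapted

variable {s t : ℕ}

theorem measurable_history_z (n : Fin N) (h : s < t) : Measurable[X.history t] (X.z n s) := by
  refine Measurable.mono (comap_measurable _) ?_ le_rfl
  refine le_sup_of_le_left (le_sup_of_le_left (le_sup_of_le_left (le_sup_of_le_right ?_)))
  exact le_iSup_of_le n (le_iSup_of_le s (le_iSup_of_le h le_rfl))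

theorem measurable_history_d (h : s < t) : Measurable[X.history t] (X.d s) := by
  refine Measurable.mono (comap_measurable _) ?_ le_rfl
  refine le_sup_of_le_left (le_sup_of_le_left (le_sup_of_le_right ?_))
  exact le_iSup_of_le s (le_iSup_of_le h le_rfl)

/-- `Q[t]` involves only slots before `t`. This lets the queue act as a known quantity in the
renewal property and makes it independent of `d[t]`. -/
theorem measurable_history_queue (t : ℕ) :
    Measurable[X.history t] fun ω => X.queue ω t :=
  measurable_queue t (fun n _ h => measurable_history_z n h) (fun _ h => measurable_history_d h)
    t le_rfl

end Adapted

namespace IsRunOf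

variable [MeasurableSpace Ω] {P : Measure Ω} {κ : (n : Fin N) → Kernel (A n) (Frame L)}
  {ν : Measure (Fin L → ℝ)}

theorem measurable_start (hX : X.IsRunOf P κ ν) (n : Fin N) (k : ℕ) :
    Measurable (X.start n k) :=
  Finset.measurable_sum _ fun i _ => hX.measurable_duration n i

theorem measurableSet_start (hX : X.IsRunOf P κ ν) (n : Fin N) (k s : ℕ) :
    MeasurableSet {ω | X.start n k ω = s} :=
  hX.measurable_start n k (measurableSet_singleton s)

theorem measurableSet_duration (hX : X.IsRunOf P κ ν) (n : Fin N) (k m : ℕ) :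
    MeasurableSet {ω | (X.duration n k ω : ℕ) = m} :=
  hX.measurable_duration n k (measurableSet_singleton m)

theorem history_le (hX : X.IsRunOf P κ ν) (t : ℕ) : X.history t ≤ ‹MeasurableSpace Ω› := by
  refine sup_le (sup_le (sup_le (sup_le ?_ ?_) ?_) ?_) ?_
  · exact iSup_le fun n => iSup_le fun s => iSup_le fun _ => (hX.measurable_y n s).comap_le
  · exact iSup_le fun n => iSup_le fun s => iSup_le fun _ => (hX.measurable_z n s).comap_le
  · exact iSup_le fun s => iSup_le fun _ => (hX.measurable_d s).comap_le
  · refine MeasurableSpace.generateFrom_le ?_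
    rintro _ ⟨n, k, s, _, rfl⟩
    exact hX.measurableSet_start n k s
  · refine MeasurableSpace.generateFrom_le ?_
    rintro _ ⟨n, k, s, D, _, hD, rfl⟩
    exact (hX.measurableSet_start n k s).inter (hX.measurable_action n k hD)

theorem measurable_frame (hX : X.IsRunOf P κ ν) (n : Fin N) (k : ℕ) :
    Measurable (X.frame n k) := by
  intro S hS
  have h : X.frame n k ⁻¹' S = ⋃ (T : ℕ+) (s : ℕ),
      {ω | (X.duration n k ω : ℕ) = T} ∩ {ω | X.start n k ω = s} ∩
        {ω | (⟨T, fun j => (X.y n (s + j) ω, X.z n (s + j) ω)⟩ : Frame L) ∈ S} := by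
    ext ω
    simp only [Set.mem_preimage, Set.mem_iUnion, Set.mem_inter_iff, Set.mem_ofPred_eq, PNat.coe_inj]
    constructor
    · intro h
      exact ⟨_, _, ⟨rfl, rfl⟩, h⟩
    · rintro ⟨T, s, ⟨rfl, rfl⟩, h⟩
      exact h
  rw [h]
  refine MeasurableSet.iUnion fun T => MeasurableSet.iUnion fun s =>
    ((hX.measurableSet_duration n k T).inter (hX.measurableSet_start n k s)).inter ?_
  refine (Frame.measurable_mk T).comp (measurable_pi_iff.2 fun j => ?_) hS
  exact (hX.measurable_y n _).prodMk (hX.measurable_z n _)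

theorem ae_forall_external (hX : X.IsRunOf P κ ν) {p : (Fin L → ℝ) → Prop}
    (h : ∀ᵐ x ∂ν, p x) : ∀ᵐ ω ∂P, ∀ t, p (X.d t ω) := by
  refine ae_all_iff.2 fun t => ?_
  rw [← hX.law_d t] at h
  exact ae_of_ae_map (hX.measurable_d t).aemeasurable h

variable [IsProbabilityMeasure P] [∀ n, IsMarkovKernel (κ n)]

/-- On the event that a frame starts in slot `s`, the joint law of a quantity known at the start
of slot `s`, the decision and the outcome of the frame. -/
theorem map_prod_frame (hX : X.IsRunOf P κ ν) (n : Fin N) (k s : ℕ) {β : Type*}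
    [MeasurableSpace β] {R : Ω → β} (hR : Measurable[X.history s] R) :
    (P.restrict {ω | X.start n k ω = s}).map (fun ω => ((R ω, X.action n k ω), X.frame n k ω)) =
      ((P.restrict {ω | X.start n k ω = s}).map fun ω => (R ω, X.action n k ω)) ⊗ₘ
        ((κ n).prodMkLeft β) := by
  have hR' : Measurable R := hR.mono (hX.history_le s) le_rfl
  have hα := hX.measurable_action n k
  have hF := hX.measurable_frame n k
  have hRα : Measurable fun ω => (R ω, X.action n k ω) := hR'.prodMk hα
  have hE := hX.measurableSet_start n k s
  -- Finite measures on a triple product are determined by boxes, and on a box the claim is the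
  -- renewal property with `H = R ⁻¹' G`.
  refine Measure.ext_prod₃' fun {G D S} hG hD hS => ?_
  rw [Measure.map_apply (hRα.prodMk hF) ((hG.prod hD).prod hS),
    Measure.restrict_apply ((hRα.prodMk hF) ((hG.prod hD).prod hS)),
    Measure.compProd_apply_prod (hG.prod hD) hS,
    setLIntegral_map (hG.prod hD) (Kernel.measurable_coe _ hS) hRα,
    Measure.restrict_restrict (hRα (hG.prod hD))]
  have h := hX.renewal n k s (R ⁻¹' G) D S (hR hG) hD hS
  have e1 : (fun ω => ((R ω, X.action n k ω), X.frame n k ω)) ⁻¹' ((G ×ˢ D) ×ˢ S) ∩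
      {ω | X.start n k ω = s} = R ⁻¹' G ∩ {ω | X.start n k ω = s} ∩ {ω | X.action n k ω ∈ D} ∩
        {ω | X.frame n k ω ∈ S} := by
    ext ω; simp only [Set.mem_inter_iff, Set.mem_preimage, Set.mem_prod, Set.mem_ofPred_eq]; tauto
  have e2 : (fun ω => (R ω, X.action n k ω)) ⁻¹' (G ×ˢ D) ∩
      {ω | X.start n k ω = s} = R ⁻¹' G ∩ {ω | X.start n k ω = s} ∩ {ω | X.action n k ω ∈ D} := by
    ext ω; simp only [Set.mem_inter_iff, Set.mem_preimage, Set.mem_prod, Set.mem_ofPred_eq]; tauto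
  rw [e1, e2, h]
  rfl

theorem setLIntegral_frame (hX : X.IsRunOf P κ ν) (n : Fin N) (k s : ℕ)
    {f : Frame L → ℝ≥0∞} (hf : Measurable f) :
    ∫⁻ ω in {ω | X.start n k ω = s}, f (X.frame n k ω) ∂P =
      ∫⁻ ω in {ω | X.start n k ω = s}, ∫⁻ o, f o ∂(κ n (X.action n k ω)) ∂P := by
  have hR : Measurable[X.history s] fun _ : Ω => () := measurable_const
  have hRα : Measurable fun ω => ((), X.action n k ω) :=
    measurable_const.prodMk (hX.measurable_action n k)
  have hf' : Measurable fun p : (Unit × A n) × Frame L => f p.2 := hf.comp measurable_snd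
  have h := congrArg (fun m => ∫⁻ p, f p.2 ∂m) (hX.map_prod_frame n k s hR)
  rw [lintegral_map hf' (hRα.prodMk (hX.measurable_frame n k)),
    Measure.lintegral_compProd hf',
    lintegral_map (Measurable.lintegral_kernel hf) hRα] at h
  exact h

/-- Conditioning on the decision and the past: `R` is frozen while the frame is averaged under its
law. Fixing the starting slot `s` avoids σ-algebras of stopping times. -/
theorem setIntegral_frame (hX : X.IsRunOf P κ ν) (n : Fin N) (k s : ℕ) {β : Type*}
    [MeasurableSpace β] {R : Ω → β} (hR : Measurable[X.history s] R)
    {f : β → Frame L → ℝ} (hf : Measurable (Function.uncurry f))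
    (hint : IntegrableOn (fun ω => f (R ω) (X.frame n k ω)) {ω | X.start n k ω = s} P) :
    ∫ ω in {ω | X.start n k ω = s}, f (R ω) (X.frame n k ω) ∂P =
      ∫ ω in {ω | X.start n k ω = s}, ∫ o, f (R ω) o ∂(κ n (X.action n k ω)) ∂P := by
  have hR' : Measurable R := hR.mono (hX.history_le s) le_rfl
  have hRα : Measurable fun ω => (R ω, X.action n k ω) := hR'.prodMk (hX.measurable_action n k)
  have hRαF := hRα.prodMk (hX.measurable_frame n k)
  have hg : Measurable fun p : (β × A n) × Frame L => f p.1.1 p.2 :=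
    hf.comp (measurable_fst.fst.prodMk measurable_snd)
  have hlaw := hX.map_prod_frame n k s hR
  have hi : Integrable (fun p : (β × A n) × Frame L => f p.1.1 p.2)
      ((P.restrict {ω | X.start n k ω = s}).map
        (fun ω => ((R ω, X.action n k ω), X.frame n k ω))) :=
    (integrable_map_measure hg.aestronglyMeasurable hRαF.aemeasurable).2 hint
  have h := congrArg (fun m => ∫ p, f p.1.1 p.2 ∂m) hlaw
  rw [integral_map hRαF.aemeasurable hg.aestronglyMeasurable,
    Measure.integral_compProd (hlaw ▸ hi),
    integral_map hRα.aemeasurable] at h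
  · exact h
  · exact (StronglyMeasurable.integral_kernel_prod_right'
      (κ := (κ n).prodMkLeft β) hg.stronglyMeasurable).aestronglyMeasurable

/-- An almost sure property of the slots of frames holds almost surely in every slot of a run. -/
theorem ae_forall_slot (hX : X.IsRunOf P κ ν) {p : ℝ × (Fin L → ℝ) → Prop}
    (hp : MeasurableSet {x | p x}) (n : Fin N) (h : ∀ a, ∀ᵐ o ∂(κ n a), ∀ j, p (o.2 j)) :
    ∀ᵐ ω ∂P, ∀ t, p (X.y n t ω, X.z n t ω) := by
  have hS := Frame.measurableSet_forall_slot hp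
  have h1 : ∀ k s, ∀ᵐ ω ∂P, X.start n k ω = s → ∀ j, p ((X.frame n k ω).2 j) := by
    intro k s
    refine (ae_restrict_iff' (hX.measurableSet_start n k s)).1 ?_
    -- The set of bad frames is null under every frame law, hence null for each of the countably
    -- many pairs `(k, s)`.
    have h2 := hX.setLIntegral_frame n k s
      (f := Set.indicator {o | ∀ j, p (o.2 j)}ᶜ 1) (measurable_one.indicator hS.compl)
    have h3 : ∀ a, ∫⁻ o, Set.indicator {o : Frame L | ∀ j, p (o.2 j)}ᶜ 1 o ∂(κ n a) = 0 := by
      intro a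
      rw [lintegral_indicator_one hS.compl]
      exact h a
    simp only [h3, lintegral_zero] at h2
    have h4 := (lintegral_eq_zero_iff
      ((measurable_one.indicator hS.compl).comp (hX.measurable_frame n k))).1 h2
    filter_upwards [h4] with ω hω
    by_contra hc
    simp [Set.indicator, hc] at hω
  have h2 : ∀ᵐ ω ∂P, ∀ k s, X.start n k ω = s → ∀ j, p ((X.frame n k ω).2 j) :=
    ae_all_iff.2 fun k => ae_all_iff.2 fun s => h1 k s
  filter_upwards [h2] with ω hω t
  obtain ⟨k, j, hj, rfl⟩ := X.exists_slot_mem_frame n ω t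
  exact hω k _ rfl ⟨j, hj⟩

end IsRunOf

end Run

/-! ### Truncated sums, residual moments and frame costs -/

theorem integrable_and_integral_le_of_lintegral_le {Ω : Type*} [MeasurableSpace Ω]
    {μ : Measure Ω} {f : Ω → ℝ} (hf : AEStronglyMeasurable f μ) (hf0 : ∀ ω, 0 ≤ f ω) {c : ℝ}
    (hc : 0 ≤ c) (h : ∫⁻ ω, ENNReal.ofReal (f ω) ∂μ ≤ ENNReal.ofReal c) :
    Integrable f μ ∧ ∫ ω, f ω ∂μ ≤ c := by
  refine ⟨⟨hf, ?_⟩, ?_⟩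
  · rw [hasFiniteIntegral_iff_ofReal (ae_of_all _ hf0)]
    exact h.trans_lt ENNReal.ofReal_lt_top
  · rw [integral_eq_lintegral_of_nonneg_ae (ae_of_all _ hf0) hf]
    exact ENNReal.toReal_le_of_le_ofReal hc h

/-- Here `m` is the time left until the horizon. Slots past it are missing on the left but counted
in `∑ h`, and adding them back costs at most `M` each; the increments `2 j + 1` add up to the square
of the duration. -/
theorem sum_truncated_le {a h : ℕ → ℝ} {M K : ℝ} (hK : 0 ≤ K) (m D : ℕ)
    (ha : ∀ j < D, j < m → a j ≤ h j + K * (2 * j + 1)) (hh : ∀ j < D, |h j| ≤ M) :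
    ∑ j ∈ range D, (if j < m then a j else 0) ≤
      ∑ j ∈ range D, h j + M * ((D - m : ℕ) : ℝ) + K * (D : ℝ) ^ 2 := by
  induction D with
  | zero => simp
  | succ D ih =>
    have ih := ih (fun j hj => ha j (by omega)) (fun j hj => hh j (by omega))
    rw [Finset.sum_range_succ, Finset.sum_range_succ]
    have h1 := ha D (by omega)
    have h2 := (abs_le.1 (hh D (by omega))).1
    push_cast
    by_cases hD : D < m
    · rw [if_pos hD, show D + 1 - m = 0 by omega]
      rw [show D - m = 0 by omega] at ih
      have := h1 hD
      linarith
    · rw [if_neg hD, show D + 1 - m = (D - m) + 1 by omega]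
      push_cast
      nlinarith [mul_nonneg hK (Nat.cast_nonneg (α := ℝ) D)]

namespace Frame

variable {L : ℕ}

/-- Given that a frame is still running after `s` slots, the second moment of its remaining
duration is at most `B`. -/
def ResidualBound (B : ℝ) (μ : Measure (Frame L)) : Prop :=
  ∀ s : ℕ, 0 < μ {o | s ≤ o.duration} →
    ∫⁻ o, ENNReal.ofReal (((o.duration : ℝ) - s) ^ 2) ∂(μ[|{o | s ≤ o.duration}]) ≤
      ENNReal.ofReal B

/-- The conditional bound multiplied by the probability of its event. Natural subtraction makes the
residual vanish off that event, so the null case needs no conditioning. -/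
theorem ResidualBound.lintegral_le {B : ℝ} {μ : Measure (Frame L)} [IsFiniteMeasure μ]
    (h : ResidualBound B μ) (m : ℕ) :
    ∫⁻ o, ENNReal.ofReal (((o.duration - m : ℕ) : ℝ) ^ 2) ∂μ ≤
      ENNReal.ofReal B * μ {o | m ≤ o.duration} := by
  set S : Set (Frame L) := {o | m ≤ o.duration} with hSdef
  have hS : MeasurableSet S := measurableSet_le_duration m
  have h1 : ∫⁻ o, ENNReal.ofReal (((o.duration - m : ℕ) : ℝ) ^ 2) ∂μ =
      ∫⁻ o in S, ENNReal.ofReal (((o.duration : ℝ) - m) ^ 2) ∂μ := by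
    rw [← lintegral_indicator hS]
    refine lintegral_congr fun o => ?_
    by_cases ho : o ∈ S
    · rw [Set.indicator_of_mem ho, Nat.cast_sub ho]
    · rw [Set.indicator_of_notMem ho]
      have : o.duration - m = 0 := by
        simp only [hSdef, Set.mem_ofPred_eq, not_le] at ho
        omega
      simp [this]
  rw [h1]
  by_cases h0 : μ S = 0
  · rw [Measure.restrict_eq_zero.2 h0]
    simp
  · have h2 := h m (pos_iff_ne_zero.2 h0)
    rw [ProbabilityTheory.cond, lintegral_smul_measure, smul_eq_mul] at h2
    calc ∫⁻ o in S, ENNReal.ofReal (((o.duration : ℝ) - m) ^ 2) ∂μ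
        = μ S * ((μ S)⁻¹ * ∫⁻ o in S, ENNReal.ofReal (((o.duration : ℝ) - m) ^ 2) ∂μ) := by
          rw [← mul_assoc, ENNReal.mul_inv_cancel h0 (measure_ne_top μ S), one_mul]
      _ ≤ μ S * ENNReal.ofReal B := by gcongr
      _ = _ := mul_comm _ _

theorem ResidualBound.integrable_duration {B : ℝ} {μ : Measure (Frame L)}
    [IsProbabilityMeasure μ] (h : ResidualBound B μ) (hB : 0 ≤ B) :
    Integrable (fun o : Frame L => (o.duration : ℝ)) μ := by
  have h1 := h.lintegral_le 0
  simp only [Nat.sub_zero, zero_le, Set.ofPred_true, measure_univ, mul_one] at h1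
  have hm : Measurable fun o : Frame L => (o.duration : ℝ) :=
    measurable_from_top.comp measurable_duration
  have h2 := (integrable_and_integral_le_of_lintegral_le (f := fun o : Frame L =>
    (o.duration : ℝ) ^ 2) (hm.pow_const 2).aestronglyMeasurable (fun _ => sq_nonneg _) hB h1).1
  refine h2.mono' hm.aestronglyMeasurable (ae_of_all _ fun o => ?_)
  have : (1 : ℝ) ≤ o.duration := by exact_mod_cast o.1.pos
  rw [Real.norm_of_nonneg (by positivity)]
  nlinarith

/-- The total over the slots of a frame of an affine cost of penalty and metrics. -/
noncomputable def cost (v : ℝ) (r : (Fin L → ℝ) × ℝ) (o : Frame L) : ℝ :=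
  ∑ j, (v * (o.2 j).1 + ∑ l, r.1 l * (o.2 j).2 l - r.2)

theorem cost_eq (v : ℝ) (r : (Fin L → ℝ) × ℝ) (o : Frame L) :
    cost v r o = v * o.totalPenalty + ∑ l, r.1 l * o.totalMetric l - r.2 * o.duration := by
  simp only [cost, totalPenalty, totalMetric, duration, Finset.sum_sub_distrib,
    Finset.sum_add_distrib, Finset.mul_sum]
  rw [Finset.sum_comm]
  simp [mul_comm]

theorem measurable_cost (v : ℝ) :
    Measurable (Function.uncurry (cost v : (Fin L → ℝ) × ℝ → Frame L → ℝ)) := by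
  have h : Function.uncurry (cost v : (Fin L → ℝ) × ℝ → Frame L → ℝ) = fun p =>
      v * p.2.totalPenalty + ∑ l, p.1.1 l * p.2.totalMetric l - p.1.2 * p.2.duration := by
    ext p
    exact cost_eq v p.1 p.2
  rw [h]
  have h1 : Measurable fun p : ((Fin L → ℝ) × ℝ) × Frame L => (p.2.duration : ℝ) :=
    (measurable_from_top.comp measurable_duration).comp measurable_snd
  have h2 := measurable_totalPenalty (L := L)
  have h3 := measurable_totalMetric (L := L)
  refine Measurable.sub (Measurable.add ?_ ?_) ?_
  · exact (h2.comp measurable_snd).const_mul v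
  · exact Finset.measurable_sum _ fun l _ =>
      ((measurable_pi_apply l).comp measurable_fst.fst).mul ((h3 l).comp measurable_snd)
  · exact measurable_fst.snd.mul h1

theorem abs_cost_le {v : ℝ} {r : (Fin L → ℝ) × ℝ} {o : Frame L} {M : ℝ}
    (h : ∀ j, |v * (o.2 j).1 + ∑ l, r.1 l * (o.2 j).2 l - r.2| ≤ M) :
    |cost v r o| ≤ M * o.duration := by
  refine (Finset.abs_sum_le_sum_abs _ _).trans ((Finset.sum_le_sum fun j _ => h j).trans ?_)
  simp [duration, mul_comm]

theorem abs_affine_le {v ymax zmax c x : ℝ} {w z : Fin L → ℝ} (hy : |x| ≤ ymax)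
    (hz : ∀ l, |z l| ≤ zmax) :
    |v * x + ∑ l, w l * z l - c| ≤ |v| * ymax + (∑ l, |w l|) * zmax + |c| := by
  have h1 : |∑ l, w l * z l| ≤ (∑ l, |w l|) * zmax := by
    rw [Finset.sum_mul]
    refine (Finset.abs_sum_le_sum_abs _ _).trans (Finset.sum_le_sum fun l _ => ?_)
    rw [abs_mul]
    exact mul_le_mul_of_nonneg_left (hz l) (abs_nonneg _)
  have h2 : |v * x| ≤ |v| * ymax := by
    rw [abs_mul]; exact mul_le_mul_of_nonneg_left hy (abs_nonneg _)
  calc _ ≤ |v * x + ∑ l, w l * z l| + |c| := abs_sub _ _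
    _ ≤ |v * x| + |∑ l, w l * z l| + |c| := by gcongr; exact abs_add_le _ _
    _ ≤ _ := by gcongr

end Frame

section Performance

variable {A : Type u} [MeasurableSpace A] {L : ℕ} {κ : Kernel A (Frame L)} [IsMarkovKernel κ]
  {ymax zmax B : ℝ} {a : A}

theorem one_le_expDuration (hB : 0 ≤ B) (hres : Frame.ResidualBound B (κ a)) :
    1 ≤ expDuration κ a := by
  have h := integral_mono (integrable_const (1 : ℝ)) (hres.integrable_duration hB)
    (fun o => (by exact_mod_cast o.1.pos : (1 : ℝ) ≤ o.duration))
  simpa [expDuration] using h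

/-- Turns a comparison of ratios into the sign of an expectation: the mean cost relative to `c` is
nonpositive exactly when the ratio is at most `c`, as the mean duration is positive. -/
theorem integral_cost (hB : 0 ≤ B) (hres : Frame.ResidualBound B (κ a))
    (hyz : ∀ᵐ o ∂(κ a), ∀ j, |(o.2 j).1| ≤ ymax ∧ ∀ l, |(o.2 j).2 l| ≤ zmax)
    (v : ℝ) (w : Fin L → ℝ) (c : ℝ) :
    ∫ o, Frame.cost v (w, c) o ∂(κ a) = expDuration κ a * (dppRatio κ v w a - c) := by
  have hT := one_le_expDuration hB hres
  have hi := hres.integrable_duration hB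
  have hm : Measurable (Frame.cost v (w, (0 : ℝ)) : Frame L → ℝ) :=
    (Frame.measurable_cost v).comp (measurable_const.prodMk measurable_id)
  have h0 : Integrable (Frame.cost v (w, (0 : ℝ)) : Frame L → ℝ) (κ a) := by
    refine (hi.const_mul (|v| * ymax + (∑ l, |w l|) * zmax + |0|)).mono'
      hm.aestronglyMeasurable ?_
    filter_upwards [hyz] with o ho
    exact Frame.abs_cost_le fun j => Frame.abs_affine_le (ho j).1 (ho j).2
  have h1 : ∀ o : Frame L, Frame.cost v (w, c) o = Frame.cost v (w, 0) o - c * o.duration := by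
    intro o; simp [Frame.cost_eq]
  have h2 : ∀ o : Frame L, Frame.cost v (w, (0 : ℝ)) o =
      ∑ j, (v * (o.2 j).1 + ∑ l, w l * (o.2 j).2 l) := by
    intro o; simp [Frame.cost]
  simp_rw [h1]
  rw [integral_sub h0 (hi.const_mul c), integral_const_mul]
  simp_rw [h2, dppRatio]
  have : expDuration κ a ≠ 0 := by positivity
  change _ - c * expDuration κ a = _
  field_simp

end Performance

/-! ### Comparing a run with a benchmark, frame by frame -/

namespace Run.IsRunOf

variable {N : ℕ} {A : Fin N → Type u} {L : ℕ} {Ω : Type v} {X : Run A L Ω}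
  [∀ n, MeasurableSpace (A n)] [MeasurableSpace Ω] {P : Measure Ω}
  {κ : (n : Fin N) → Kernel (A n) (Frame L)} {ν : Measure (Fin L → ℝ)}
  [IsProbabilityMeasure P] {B ymax zmax : ℝ} {n : Fin N}

theorem sum_overshoot_prob_le_one (hX : X.IsRunOf P κ ν) (T : ℕ) :
    ∑ k ∈ range T, ∑ s ∈ range T,
      P.real ({ω | X.start n k ω = s} ∩ {ω | T - s ≤ (X.duration n k ω : ℕ)}) ≤ 1 := by
  have hS : ∀ k s, MeasurableSet
      ({ω | X.start n k ω = s} ∩ {ω | T - s ≤ (X.duration n k ω : ℕ)}) := fun k s =>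
    (hX.measurableSet_start n k s).inter
      (hX.measurable_duration n k (measurableSet_Ici (a := T - s)))
  have hi : ∀ k s, Integrable (Set.indicator
      ({ω | X.start n k ω = s} ∩ {ω | T - s ≤ (X.duration n k ω : ℕ)}) (1 : Ω → ℝ)) P :=
    fun k s => (integrable_const (1 : ℝ)).indicator (hS k s)
  have h1 : ∑ k ∈ range T, ∑ s ∈ range T,
      P.real ({ω | X.start n k ω = s} ∩ {ω | T - s ≤ (X.duration n k ω : ℕ)}) =
      ∫ ω, ∑ k ∈ range T, ∑ s ∈ range T, Set.indicator
        ({ω | X.start n k ω = s} ∩ {ω | T - s ≤ (X.duration n k ω : ℕ)}) (1 : Ω → ℝ) ω ∂P := by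
    rw [integral_finsetSum _ fun k _ => integrable_finsetSum _ fun s _ => hi k s]
    refine Finset.sum_congr rfl fun k _ => ?_
    rw [integral_finsetSum _ fun s _ => hi k s]
    exact Finset.sum_congr rfl fun s _ => (integral_indicator_one (hS k s)).symm
  rw [h1]
  refine (integral_mono (g := fun _ => (1 : ℝ))
    (integrable_finsetSum _ fun k _ => integrable_finsetSum _ fun s _ => hi k s)
    (integrable_const _) fun ω => ?_).trans (by simp)
  refine le_trans (Finset.sum_le_sum fun k _ => ?_) (X.sum_indicator_residual_le_one n ω T T)
  have h2 : ∀ s, Set.indicator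
      ({ω | X.start n k ω = s} ∩ {ω | T - s ≤ (X.duration n k ω : ℕ)}) (1 : Ω → ℝ) ω =
      if X.start n k ω = s then (if T - s ≤ (X.duration n k ω : ℕ) then 1 else 0) else 0 := by
    intro s
    simp only [Set.indicator, Set.mem_inter_iff, Set.mem_ofPred_eq, Pi.one_apply, ite_and]
  simp only [h2, Finset.sum_ite_eq, Finset.mem_range, X.start_succ]
  split_ifs <;> first | (norm_num; done) | omega

theorem sum_start_prob_le (hX : X.IsRunOf P κ ν) (T : ℕ) :
    ∑ k ∈ range T, ∑ s ∈ range T, P.real {ω | X.start n k ω = s} ≤ T := by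
  have h : ∀ k, ∑ s ∈ range T, P.real {ω | X.start n k ω = s} ≤ 1 := by
    intro k
    rw [← measureReal_biUnion_finset]
    · exact measureReal_le_one
    · intro s _ s' _ hne
      rw [Function.onFun, Set.disjoint_left]
      rintro ω rfl h
      exact hne h
    · exact fun s _ => hX.measurableSet_start n k s
  refine (Finset.sum_le_sum fun k _ => h k).trans (by simp)

variable [∀ n, IsMarkovKernel (κ n)]

/-- Keeping the probability of survival on the right is essential: summed over frames with `m = T -
s` it gives at most one, so the overshoot costs `B` in total, not `B` per frame. -/
theorem residual_sq (hX : X.IsRunOf P κ ν) (hB : 0 ≤ B)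
    (hres : ∀ a, Frame.ResidualBound B (κ n a)) (k s m : ℕ) :
    IntegrableOn (fun ω => (((X.duration n k ω : ℕ) - m : ℕ) : ℝ) ^ 2)
        {ω | X.start n k ω = s} P ∧
      ∫ ω in {ω | X.start n k ω = s}, (((X.duration n k ω : ℕ) - m : ℕ) : ℝ) ^ 2 ∂P ≤
        B * P.real ({ω | X.start n k ω = s} ∩ {ω | m ≤ (X.duration n k ω : ℕ)}) := by
  have hmeas : Measurable fun ω => (((X.duration n k ω : ℕ) - m : ℕ) : ℝ) ^ 2 :=
    (measurable_from_top (f := fun D : ℕ => ((D - m : ℕ) : ℝ) ^ 2)).comp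
      (hX.measurable_duration n k)
  have hf : Measurable fun o : Frame L => ENNReal.ofReal (((o.duration - m : ℕ) : ℝ) ^ 2) :=
    (measurable_from_top (f := fun D : ℕ => ENNReal.ofReal (((D - m : ℕ) : ℝ) ^ 2))).comp
      Frame.measurable_duration
  have hS := Frame.measurableSet_le_duration (L := L) m
  refine integrable_and_integral_le_of_lintegral_le hmeas.aestronglyMeasurable
    (fun _ => sq_nonneg _) (by positivity) ?_
  have h1 := hX.setLIntegral_frame n k s hf
  have h2 := hX.setLIntegral_frame n k s (f := Set.indicator {o | m ≤ o.duration} 1)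
    (measurable_one.indicator hS)
  simp only [lintegral_indicator_one hS] at h2
  have h3 : ∫⁻ ω in {ω | X.start n k ω = s},
      Set.indicator {o : Frame L | m ≤ o.duration} 1 (X.frame n k ω) ∂P =
      P ({ω | X.start n k ω = s} ∩ {ω | m ≤ (X.duration n k ω : ℕ)}) := by
    have hS' : MeasurableSet {ω | m ≤ (X.duration n k ω : ℕ)} := hX.measurable_frame n k hS
    rw [Set.inter_comm, ← Measure.restrict_apply hS', ← lintegral_indicator_one hS']
    rfl
  calc _ = _ := h1
    _ ≤ ∫⁻ ω in {ω | X.start n k ω = s}, ENNReal.ofReal B *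
          κ n (X.action n k ω) {o | m ≤ o.duration} ∂P :=
        lintegral_mono fun ω => (hres _).lintegral_le m
    _ = ENNReal.ofReal B * P ({ω | X.start n k ω = s} ∩ {ω | m ≤ (X.duration n k ω : ℕ)}) := by
        rw [lintegral_const_mul' _ _ ENNReal.ofReal_ne_top, ← h2, h3]
    _ = _ := by rw [ENNReal.ofReal_mul hB, ofReal_measureReal]

/-- The expected cost of a frame is nonpositive if the ratio of the decision is at most the
benchmark `c`, both of which may depend on the history. -/
theorem setIntegral_cost (hX : X.IsRunOf P κ ν) (hB : 0 ≤ B)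
    (hres : ∀ a, Frame.ResidualBound B (κ n a))
    (hyz : ∀ a, ∀ᵐ o ∂(κ n a), ∀ j, |(o.2 j).1| ≤ ymax ∧ ∀ l, |(o.2 j).2 l| ≤ zmax)
    (v : ℝ) {R : Ω → (Fin L → ℝ) × ℝ} {M : ℝ} (k s : ℕ) (hR : Measurable[X.history s] R)
    (hM : ∀ᵐ ω ∂P, ∀ t, |v * X.y n t ω + ∑ l, (R ω).1 l * X.z n t ω l - (R ω).2| ≤ M)
    (hopt : ∀ᵐ ω ∂P, X.start n k ω = s →
      dppRatio (κ n) v (R ω).1 (X.action n k ω) ≤ (R ω).2) :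
    IntegrableOn (fun ω => Frame.cost v (R ω) (X.frame n k ω)) {ω | X.start n k ω = s} P ∧
      ∫ ω in {ω | X.start n k ω = s}, Frame.cost v (R ω) (X.frame n k ω) ∂P ≤ 0 := by
  have hE := hX.measurableSet_start n k s
  have hR' : Measurable R := hR.mono (hX.history_le s) le_rfl
  have hmeas : Measurable fun ω => Frame.cost v (R ω) (X.frame n k ω) :=
    (Frame.measurable_cost v).comp (hR'.prodMk (hX.measurable_frame n k))
  have h0 := (hX.residual_sq hB hres k s 0).1
  have hi : IntegrableOn (fun ω => Frame.cost v (R ω) (X.frame n k ω))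
      {ω | X.start n k ω = s} P := by
    refine (h0.const_mul M).mono' hmeas.aestronglyMeasurable (ae_restrict_of_ae ?_)
    filter_upwards [hM] with ω hω
    have h1 : |Frame.cost v (R ω) (X.frame n k ω)| ≤ M * (X.duration n k ω : ℕ) :=
      Frame.abs_cost_le fun j => hω _
    have h2 : 0 ≤ M := (abs_nonneg _).trans (hω 0)
    have h3 : (1 : ℝ) ≤ (X.duration n k ω : ℕ) := by exact_mod_cast (X.duration n k ω).pos
    refine h1.trans (mul_le_mul_of_nonneg_left ?_ h2)
    simp only [Nat.sub_zero]
    nlinarith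
  refine ⟨hi, ?_⟩
  rw [hX.setIntegral_frame n k s hR (Frame.measurable_cost v) hi]
  refine integral_nonpos_of_ae ((ae_restrict_iff' hE).2 ?_)
  filter_upwards [hopt] with ω hω hs
  have h1 := integral_cost hB (hres (X.action n k ω)) (hyz (X.action n k ω)) v (R ω).1 (R ω).2
  have h2 := one_le_expDuration hB (hres (X.action n k ω))
  rw [Prod.mk.eta] at h1
  rw [h1]
  exact mul_nonpos_of_nonneg_of_nonpos (by linarith) (by linarith [hω hs])

/-- Comparison of a run with a benchmark, frame by frame. -/
theorem integral_sum_le (hX : X.IsRunOf P κ ν) (hB : 0 ≤ B)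
    (hres : ∀ a, Frame.ResidualBound B (κ n a))
    (hyz : ∀ a, ∀ᵐ o ∂(κ n a), ∀ j, |(o.2 j).1| ≤ ymax ∧ ∀ l, |(o.2 j).2 l| ≤ zmax)
    (v : ℝ) {R : ℕ → Ω → (Fin L → ℝ) × ℝ} {M K : ℝ} {T : ℕ} (hM0 : 0 ≤ M) (hK : 0 ≤ K)
    (hR : ∀ s, Measurable[X.history s] (R s))
    (hM : ∀ᵐ ω ∂P, ∀ s < T, ∀ t,
      |v * X.y n t ω + ∑ l, (R s ω).1 l * X.z n t ω l - (R s ω).2| ≤ M)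
    (hopt : ∀ᵐ ω ∂P, ∀ k s, X.start n k ω = s →
      dppRatio (κ n) v (R s ω).1 (X.action n k ω) ≤ (R s ω).2)
    {φ : ℕ → Ω → ℝ} (hφi : ∀ t < T, Integrable (φ t) P)
    (hφ : ∀ᵐ ω ∂P, ∀ s j, s + j < T → φ (s + j) ω ≤
      v * X.y n (s + j) ω + ∑ l, (R s ω).1 l * X.z n (s + j) ω l - (R s ω).2 +
        K * (2 * j + 1)) :
    ∑ t ∈ range T, ∫ ω, φ t ω ∂P ≤ M * B + K * B * T := by
  have hE := fun k s => hX.measurableSet_start n k s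
  have hcost : ∀ k, ∀ s < T, _ := fun k s hs =>
    hX.setIntegral_cost hB hres hyz v k s (hR s) (hM.mono fun ω h => h s hs)
      (hopt.mono fun ω h => h k s)
  -- The three terms bound, in order, the whole frame against its benchmark, the part lost past the
  -- horizon, and the drift of the weights within the frame.
  set G : ℕ → ℕ → Ω → ℝ := fun k s ω => Frame.cost v (R s ω) (X.frame n k ω) +
    M * (((X.duration n k ω : ℕ) - (T - s) : ℕ) : ℝ) ^ 2 +
    K * (((X.duration n k ω : ℕ) - 0 : ℕ) : ℝ) ^ 2
  have hr := fun k s => hX.residual_sq hB hres k s (T - s)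
  have hd := fun k s => hX.residual_sq hB hres k s 0
  have hGi : ∀ k, ∀ s < T, IntegrableOn (G k s) {ω | X.start n k ω = s} P := fun k s hs =>
    ((hcost k s hs).1.add ((hr k s).1.const_mul M)).add ((hd k s).1.const_mul K)
  have hGle : ∀ k, ∀ s < T, ∫ ω in {ω | X.start n k ω = s}, G k s ω ∂P ≤
      M * (B * P.real ({ω | X.start n k ω = s} ∩ {ω | T - s ≤ (X.duration n k ω : ℕ)})) +
        K * (B * P.real {ω | X.start n k ω = s}) := by
    intro k s hs
    have h1 : ∫ ω in {ω | X.start n k ω = s}, G k s ω ∂P =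
      ∫ ω in {ω | X.start n k ω = s}, Frame.cost v (R s ω) (X.frame n k ω) ∂P +
      M * ∫ ω in {ω | X.start n k ω = s}, (((X.duration n k ω : ℕ) - (T - s) : ℕ) : ℝ) ^ 2 ∂P +
      K * ∫ ω in {ω | X.start n k ω = s}, (((X.duration n k ω : ℕ) - 0 : ℕ) : ℝ) ^ 2 ∂P := by
      rw [← integral_const_mul, ← integral_const_mul, ← integral_add, ← integral_add]
      · exact (hcost k s hs).1.add ((hr k s).1.const_mul M)
      · exact (hd k s).1.const_mul K
      · exact (hcost k s hs).1
      · exact (hr k s).1.const_mul M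
    rw [h1]
    have h2 := (hcost k s hs).2
    have h3 := mul_le_mul_of_nonneg_left (hr k s).2 hM0
    have h4 := mul_le_mul_of_nonneg_left (hd k s).2 hK
    simp only [zero_le, Set.ofPred_true, Set.inter_univ] at h4
    linarith
  have hGi' : ∀ k, ∀ s ∈ range T,
      Integrable (Set.indicator {ω | X.start n k ω = s} (G k s)) P := fun k s hs =>
    (hGi k s (Finset.mem_range.1 hs)).integrable_indicator (hE k s)
  have hpath : ∀ᵐ ω ∂P, ∑ t ∈ range T, φ t ω ≤ ∑ k ∈ range T, ∑ s ∈ range T,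
      Set.indicator {ω | X.start n k ω = s} (G k s) ω := by
    filter_upwards [hM, hφ] with ω hMω hφω
    rw [X.sum_range_eq_sum_frames n ω T]
    refine Finset.sum_le_sum fun k _ => Finset.sum_le_sum fun s hs => ?_
    have hs := Finset.mem_range.1 hs
    by_cases hst : X.start n k ω = s
    · rw [if_pos hst, Set.indicator_of_mem (show ω ∈ {ω | X.start n k ω = s} from hst)]
      have h1 := sum_truncated_le hK (T - s) (X.duration n k ω)
        (a := fun j => φ (s + j) ω)
        (h := fun j => v * X.y n (s + j) ω + ∑ l, (R s ω).1 l * X.z n (s + j) ω l - (R s ω).2)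
        (fun j _ hj => hφω s j (by omega)) (fun j _ => hMω s hs (s + j))
      have h2 : ∀ j, (if j < T - s then φ (s + j) ω else 0) =
          if s + j < T then φ (s + j) ω else 0 := by
        intro j
        have : j < T - s ↔ s + j < T := by omega
        simp only [this]
      have h3 : Frame.cost v (R s ω) (X.frame n k ω) = ∑ j ∈ range (X.duration n k ω),
          (v * X.y n (s + j) ω + ∑ l, (R s ω).1 l * X.z n (s + j) ω l - (R s ω).2) := by
        rw [Finset.sum_range, ← hst]
        rfl
      simp only [h2] at h1
      refine h1.trans ?_
      simp only [G, h3, Nat.sub_zero]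
      gcongr
      -- The residual is a natural number, hence at most its square, and the second moment bound
      -- covers it.
      exact_mod_cast Nat.le_self_pow (by norm_num) _
    · rw [if_neg hst, Set.indicator_of_notMem (show ω ∉ {ω | X.start n k ω = s} from hst)]
  rw [← integral_finsetSum _ fun t ht => hφi t (Finset.mem_range.1 ht)]
  refine (integral_mono_ae (integrable_finsetSum _ fun t ht => hφi t (Finset.mem_range.1 ht))
    (integrable_finsetSum _ fun k _ => integrable_finsetSum _ (hGi' k)) hpath).trans ?_
  rw [integral_finsetSum _ fun k _ => integrable_finsetSum _ (hGi' k)]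
  have h5 : ∑ k ∈ range T, ∫ ω, ∑ s ∈ range T,
      Set.indicator {ω | X.start n k ω = s} (G k s) ω ∂P ≤
      ∑ k ∈ range T, ∑ s ∈ range T,
        (M * (B * P.real ({ω | X.start n k ω = s} ∩ {ω | T - s ≤ (X.duration n k ω : ℕ)})) +
          K * (B * P.real {ω | X.start n k ω = s})) := by
    refine Finset.sum_le_sum fun k _ => ?_
    rw [integral_finsetSum _ (hGi' k)]
    refine Finset.sum_le_sum fun s hs => ?_
    rw [integral_indicator (hE k s)]
    exact hGle k s (Finset.mem_range.1 hs)
  refine h5.trans ?_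
  simp only [Finset.sum_add_distrib, ← Finset.mul_sum]
  have h6 := hX.sum_overshoot_prob_le_one (n := n) T
  have h7 := hX.sum_start_prob_le (n := n) T
  have h8 := mul_le_mul_of_nonneg_left h6 (mul_nonneg hM0 hB)
  have h9 := mul_le_mul_of_nonneg_left h7 (mul_nonneg hK hB)
  linarith

end Run.IsRunOf

/-! ### Time averages and the benchmark of a feasible run -/

open Topology in
theorem limsup_le_of_eventuallyLE_of_tendsto {u w : ℕ → ℝ} {b c : ℝ} (hb : ∀ T, b ≤ u T)
    (hle : ∀ᶠ T in atTop, u T ≤ w T) (hw : Tendsto w atTop (𝓝 c)) : limsup u atTop ≤ c := by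
  rw [← hw.limsup_eq]
  exact limsup_le_limsup hle (isCoboundedUnder_le_of_le atTop hb) hw.isBoundedUnder_le

open Topology in
theorem le_limsup_of_tendsto_subseq {u : ℕ → ℝ} {σ : ℕ → ℕ} {b c : ℝ} (hb : ∀ T, u T ≤ b)
    (hσ : Tendsto σ atTop atTop) (hc : Tendsto (u ∘ σ) atTop (𝓝 c)) : c ≤ limsup u atTop := by
  refine le_of_forall_gt_imp_ge_of_dense fun x hx => ?_
  have h := eventually_lt_of_limsup_lt hx (isBoundedUnder_of ⟨b, hb⟩)
  exact le_of_tendsto hc ((hσ.eventually h).mono fun _ h => h.le)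

/-- Lets the upper comparison `integral_sum_le` also yield lower bounds. -/
theorem dppRatio_neg {A : Type u} [MeasurableSpace A] {L : ℕ} (κ : Kernel A (Frame L)) (V : ℝ)
    (q : Fin L → ℝ) (a : A) : dppRatio κ (-V) (-q) a = -dppRatio κ V q a := by
  have h : ∀ o : Frame L, ∑ j, (-V * (o.2 j).1 + ∑ l, (-q) l * (o.2 j).2 l) =
      -∑ j, (V * (o.2 j).1 + ∑ l, q l * (o.2 j).2 l) := by
    intro o
    rw [← Finset.sum_neg_distrib]
    refine Finset.sum_congr rfl fun j _ => ?_
    simp only [Pi.neg_apply, neg_mul, Finset.sum_neg_distrib]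
    ring
  simp only [dppRatio, h, integral_neg, neg_div]

theorem abs_average_le {x : ℕ → ℝ} {b : ℝ} (hb : 0 ≤ b) (hx : ∀ t, |x t| ≤ b) (T : ℕ) :
    |(1 / (T : ℝ)) * ∑ t ∈ range T, x t| ≤ b := by
  rcases Nat.eq_zero_or_pos T with rfl | hT
  · simpa using hb
  · have hT' : (0 : ℝ) < T := by exact_mod_cast hT
    rw [abs_mul, abs_of_pos (by positivity : (0 : ℝ) < 1 / T), one_div, inv_mul_le_iff₀ hT']
    refine (Finset.abs_sum_le_sum_abs _ _).trans ((Finset.sum_le_sum fun t _ => hx t).trans ?_)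
    simp

namespace Run.IsRunOf

variable {N : ℕ} {A : Fin N → Type u} {L : ℕ} {Ω : Type v} {X : Run A L Ω}
  [∀ n, MeasurableSpace (A n)] [MeasurableSpace Ω] {P : Measure Ω}
  {κ : (n : Fin N) → Kernel (A n) (Frame L)} {ν : Measure (Fin L → ℝ)}
  {B ymax zmax : ℝ}

theorem measurable_z_apply (hX : X.IsRunOf P κ ν) (n : Fin N) (t : ℕ) (l : Fin L) :
    Measurable fun ω => X.z n t ω l :=
  (measurable_pi_apply l).comp (hX.measurable_z n t)

variable [IsProbabilityMeasure P] [∀ n, IsMarkovKernel (κ n)]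

theorem ae_bounds (hX : X.IsRunOf P κ ν)
    (hyz : ∀ n a, ∀ᵐ o ∂(κ n a), ∀ j, |(o.2 j).1| ≤ ymax ∧ ∀ l, |(o.2 j).2 l| ≤ zmax) :
    ∀ᵐ ω ∂P, ∀ n t, |X.y n t ω| ≤ ymax ∧ ∀ l, |X.z n t ω l| ≤ zmax := by
  refine ae_all_iff.2 fun n => hX.ae_forall_slot
    (p := fun x => |x.1| ≤ ymax ∧ ∀ l, |x.2 l| ≤ zmax) ?_ n (hyz n)
  have h1 : MeasurableSet {x : ℝ × (Fin L → ℝ) | |x.1| ≤ ymax} :=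
    measurableSet_le (by fun_prop) measurable_const
  have h2 : MeasurableSet (⋂ l, {x : ℝ × (Fin L → ℝ) | |x.2 l| ≤ zmax}) :=
    MeasurableSet.iInter fun l => measurableSet_le (by fun_prop) measurable_const
  convert h1.inter h2 using 1
  ext x
  simp

theorem integrable_y (hX : X.IsRunOf P κ ν)
    (hyz : ∀ n a, ∀ᵐ o ∂(κ n a), ∀ j, |(o.2 j).1| ≤ ymax ∧ ∀ l, |(o.2 j).2 l| ≤ zmax)
    (n : Fin N) (t : ℕ) : Integrable (X.y n t) P :=
  Integrable.of_bound (hX.measurable_y n t).aestronglyMeasurable ymax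
    ((hX.ae_bounds hyz).mono fun _ h => (h n t).1)

theorem integrable_z (hX : X.IsRunOf P κ ν)
    (hyz : ∀ n a, ∀ᵐ o ∂(κ n a), ∀ j, |(o.2 j).1| ≤ ymax ∧ ∀ l, |(o.2 j).2 l| ≤ zmax)
    (n : Fin N) (t : ℕ) (l : Fin L) : Integrable (fun ω => X.z n t ω l) P :=
  Integrable.of_bound (hX.measurable_z_apply n t l).aestronglyMeasurable zmax
    ((hX.ae_bounds hyz).mono fun _ h => (h n t).2 l)

theorem abs_integral_y_le (hX : X.IsRunOf P κ ν)
    (hyz : ∀ n a, ∀ᵐ o ∂(κ n a), ∀ j, |(o.2 j).1| ≤ ymax ∧ ∀ l, |(o.2 j).2 l| ≤ zmax)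
    (n : Fin N) (t : ℕ) : |∫ ω, X.y n t ω ∂P| ≤ ymax := by
  simpa using norm_integral_le_of_norm_le_const (f := X.y n t)
    ((hX.ae_bounds hyz).mono fun _ h => (h n t).1)

theorem abs_integral_z_le (hX : X.IsRunOf P κ ν)
    (hyz : ∀ n a, ∀ᵐ o ∂(κ n a), ∀ j, |(o.2 j).1| ≤ ymax ∧ ∀ l, |(o.2 j).2 l| ≤ zmax)
    (n : Fin N) (t : ℕ) (l : Fin L) : |∫ ω, X.z n t ω l ∂P| ≤ zmax := by
  simpa using norm_integral_le_of_norm_le_const (f := fun ω => X.z n t ω l)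
    ((hX.ae_bounds hyz).mono fun _ h => (h n t).2 l)

/-- A linear functional of the performance that is at least `c` on all actions is at least `c` in
every run, up to the overshoot of the last frame. -/
theorem mul_le_sum_integral (hX : X.IsRunOf P κ ν) (hB : 0 ≤ B) (hy0 : 0 ≤ ymax)
    (hz0 : 0 ≤ zmax) (hres : ∀ n a, Frame.ResidualBound B (κ n a))
    (hyz : ∀ n a, ∀ᵐ o ∂(κ n a), ∀ j, |(o.2 j).1| ≤ ymax ∧ ∀ l, |(o.2 j).2 l| ≤ zmax)
    (n : Fin N) (v c : ℝ) (q : Fin L → ℝ) (hc : ∀ a, c ≤ dppRatio (κ n) v q a) (T : ℕ) :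
    c * T ≤ v * ∑ t ∈ range T, ∫ ω, X.y n t ω ∂P +
      ∑ l, q l * ∑ t ∈ range T, ∫ ω, X.z n t ω l ∂P +
        (|v| * ymax + (∑ l, |q l|) * zmax + |c|) * B := by
  have hyi := hX.integrable_y hyz n
  have hzi := hX.integrable_z hyz n
  have hzs : ∀ t, Integrable (fun ω => ∑ l, (-q) l * X.z n t ω l) P := fun t =>
    integrable_finsetSum _ fun l _ => (hzi t l).const_mul _
  -- All signs are reversed, and the weights are constant in time, so there is no drift within
  -- frames and `K = 0`.
  have h := hX.integral_sum_le hB (hres n) (hyz n) (-v) (R := fun _ _ => (-q, -c)) (K := 0)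
    (M := |v| * ymax + (∑ l, |q l|) * zmax + |c|) (T := T) (by positivity) le_rfl
    (fun s => measurable_const) ?_ ?_
    (φ := fun t ω => -v * X.y n t ω + ∑ l, (-q) l * X.z n t ω l - -c) ?_ ?_
  · have h1 : ∀ t, ∫ ω, (-v * X.y n t ω + ∑ l, (-q) l * X.z n t ω l - -c) ∂P =
        -v * ∫ ω, X.y n t ω ∂P + ∑ l, (-q) l * ∫ ω, X.z n t ω l ∂P + c := by
      intro t
      have h2 : Integrable (fun ω => -v * X.y n t ω + ∑ l, (-q) l * X.z n t ω l) P :=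
        ((hyi t).const_mul _).add (hzs t)
      rw [integral_sub h2 (integrable_const _), integral_add ((hyi t).const_mul _) (hzs t), integral_const_mul,
        integral_finsetSum _ fun l _ => (hzi t l).const_mul _]
      simp only [integral_const_mul, integral_const, probReal_univ, one_smul, sub_neg_eq_add]
    simp only [h1, Finset.sum_add_distrib, ← Finset.mul_sum] at h
    rw [Finset.sum_comm] at h
    simp only [← Finset.mul_sum, Pi.neg_apply, neg_mul, Finset.sum_neg_distrib] at h
    simp only [sum_const, card_range, nsmul_eq_mul] at h
    linarith
  · filter_upwards [hX.ae_bounds hyz] with ω hω s _ t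
    have := Frame.abs_affine_le (v := -v) (w := -q) (c := -c) (hω n t).1 (hω n t).2
    simpa using this
  · refine ae_of_all _ fun ω k s _ => ?_
    simp only [dppRatio_neg]
    exact neg_le_neg (hc _)
  · exact fun t _ => (((hyi t).const_mul _).add (hzs t)).sub (integrable_const _)
  · exact ae_of_all _ fun ω s j _ => by simp

open Topology in
/-- The long run averages of a run are dominated by a choice of stationary performance vectors, one
for each system, which no linear functional separates from the performance vectors of actions. -/
theorem exists_benchmark (hX : X.IsRunOf P κ ν) (hB : 0 ≤ B) (hy0 : 0 ≤ ymax)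
    (hz0 : 0 ≤ zmax) (hres : ∀ n a, Frame.ResidualBound B (κ n a))
    (hyz : ∀ n a, ∀ᵐ o ∂(κ n a), ∀ j, |(o.2 j).1| ≤ ymax ∧ ∀ l, |(o.2 j).2 l| ≤ zmax) :
    ∃ (f : Fin N → ℝ) (g : Fin N → Fin L → ℝ),
      (∀ n, |f n| ≤ ymax) ∧ (∀ n l, |g n l| ≤ zmax) ∧
      ∑ n, f n ≤ X.longRunPenalty P ∧ (∀ l, ∑ n, g n l ≤ X.longRunMetric P l) ∧
      ∀ n v c (q : Fin L → ℝ), (∀ a, c ≤ dppRatio (κ n) v q a) →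
        c ≤ v * f n + ∑ l, q l * g n l := by
  set F : ℕ → Fin N → ℝ := fun T n => 1 / (T : ℝ) * ∑ t ∈ range T, ∫ ω, X.y n t ω ∂P with hF
  set G : ℕ → Fin N → Fin L → ℝ :=
    fun T n l => 1 / (T : ℝ) * ∑ t ∈ range T, ∫ ω, X.z n t ω l ∂P with hG
  have hFb : ∀ T n, |F T n| ≤ ymax := fun T n =>
    abs_average_le hy0 (fun t => hX.abs_integral_y_le hyz n t) T
  have hGb : ∀ T n l, |G T n l| ≤ zmax := fun T n l =>
    abs_average_le hz0 (fun t => hX.abs_integral_z_le hyz n t l) T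
  have hmem : ∀ T, (F T, G T) ∈ Set.Icc (fun _ : Fin N => -ymax) (fun _ => ymax) ×ˢ
      Set.Icc (fun (_ : Fin N) (_ : Fin L) => -zmax) (fun _ _ => zmax) := fun T =>
    ⟨⟨fun n => (abs_le.1 (hFb T n)).1, fun n => (abs_le.1 (hFb T n)).2⟩,
      ⟨fun n l => (abs_le.1 (hGb T n l)).1, fun n l => (abs_le.1 (hGb T n l)).2⟩⟩
  -- One subsequence serves all systems and all metrics, so the limits can be summed; a
  -- subsequential limit is at most the limsup.
  obtain ⟨⟨f, g⟩, hfg, σ, hσ, hlim⟩ := (isCompact_Icc.prod isCompact_Icc).tendsto_subseq hmem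
  have hf : ∀ n, Tendsto (fun i => F (σ i) n) atTop (𝓝 (f n)) := fun n =>
    (tendsto_pi_nhds.1 ((continuous_fst.tendsto _).comp hlim)) n
  have hg : ∀ n l, Tendsto (fun i => G (σ i) n l) atTop (𝓝 (g n l)) := fun n l =>
    tendsto_pi_nhds.1 ((tendsto_pi_nhds.1 ((continuous_snd.tendsto _).comp hlim)) n) l
  refine ⟨f, g, fun n => abs_le.2 ⟨hfg.1.1 n, hfg.1.2 n⟩,
    fun n l => abs_le.2 ⟨hfg.2.1 n l, hfg.2.2 n l⟩, ?_, fun l => ?_, fun n v c q hc => ?_⟩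
  · have he : ∀ T : ℕ, 1 / (T : ℝ) * ∑ t ∈ range T, ∑ n, ∫ ω, X.y n t ω ∂P = ∑ n, F T n := by
      intro T
      rw [Finset.sum_comm, Finset.mul_sum]
    refine le_limsup_of_tendsto_subseq (σ := σ) (b := ∑ _n : Fin N, ymax) (fun T => ?_)
      hσ.tendsto_atTop ?_
    · rw [he]
      exact Finset.sum_le_sum fun n _ => (abs_le.1 (hFb T n)).2
    · simp only [Function.comp_def, he]
      exact tendsto_finsetSum _ fun n _ => hf n
  · have he : ∀ T : ℕ, 1 / (T : ℝ) * ∑ t ∈ range T, ∑ n, ∫ ω, X.z n t ω l ∂P =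
        ∑ n, G T n l := by
      intro T
      rw [Finset.sum_comm, Finset.mul_sum]
    refine le_limsup_of_tendsto_subseq (σ := σ) (b := ∑ _n : Fin N, zmax) (fun T => ?_)
      hσ.tendsto_atTop ?_
    · rw [he]
      exact Finset.sum_le_sum fun n _ => (abs_le.1 (hGb T n l)).2
    · simp only [Function.comp_def, he]
      exact tendsto_finsetSum _ fun n _ => hg n l
  · set C := (|v| * ymax + (∑ l, |q l|) * zmax + |c|) * B
    have h1 : ∀ T : ℕ, 0 < T → c ≤ v * F T n + ∑ l, q l * G T n l + C / T := by
      intro T hT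
      have hT' : (0 : ℝ) < T := by exact_mod_cast hT
      have h2 := hX.mul_le_sum_integral hB hy0 hz0 hres hyz n v c q hc T
      have h3 : v * F T n + ∑ l, q l * G T n l + C / T =
          (v * ∑ t ∈ range T, ∫ ω, X.y n t ω ∂P +
            ∑ l, q l * ∑ t ∈ range T, ∫ ω, X.z n t ω l ∂P + C) / T := by
        rw [add_div, add_div, Finset.sum_div]
        simp only [hF, hG]
        congr 2
        · ring
        · exact Finset.sum_congr rfl fun l _ => by ring
      rw [h3, le_div_iff₀ hT']
      exact h2
    have h2 : Tendsto (fun i => v * F (σ i) n + ∑ l, q l * G (σ i) n l + C / (σ i : ℕ)) atTop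
        (𝓝 (v * f n + ∑ l, q l * g n l + 0)) := by
      refine (((hf n).const_mul v).add (tendsto_finsetSum _ fun l _ =>
        (hg n l).const_mul (q l))).add ?_
      exact (tendsto_const_div_atTop_nhds_zero_nat C).comp hσ.tendsto_atTop
    rw [add_zero] at h2
    refine ge_of_tendsto h2 ?_
    filter_upwards [hσ.tendsto_atTop.eventually (eventually_gt_atTop 0)] with i hi
    exact h1 _ hi

end Run.IsRunOf

/-! ### Virtual queues and the drift-plus-penalty bound -/

namespace Run

variable {N : ℕ} {A : Fin N → Type u} {L : ℕ} {Ω : Type v} (X : Run A L Ω) {ω : Ω}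

theorem queue_nonneg (ω : Ω) (t : ℕ) (l : Fin L) : 0 ≤ X.queue ω t l := by
  cases t with
  | zero => exact le_rfl
  | succ t => exact le_max_right _ _

theorem sum_le_queue (ω : Ω) (T : ℕ) (l : Fin L) :
    ∑ t ∈ range T, (∑ n, X.z n t ω l - X.d t ω l) ≤ X.queue ω T l := by
  induction T with
  | zero => exact le_rfl
  | succ T ih =>
    rw [Finset.sum_range_succ]
    refine le_trans ?_ (le_max_left _ _)
    linarith

theorem abs_queue_sub_le {a : ℝ} {l : Fin L} (h : ∀ t, |∑ n, X.z n t ω l - X.d t ω l| ≤ a)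
    (s j : ℕ) : |X.queue ω (s + j) l - X.queue ω s l| ≤ a * j := by
  induction j with
  | zero => simp
  | succ j ih =>
    have h1 : |X.queue ω (s + (j + 1)) l - X.queue ω (s + j) l| ≤ a := by
      have h2 : X.queue ω (s + (j + 1)) l = max (X.queue ω (s + j) l +
        ∑ n, X.z n (s + j) ω l - X.d (s + j) ω l) 0 := rfl
      have h3 : X.queue ω (s + j) l = max (X.queue ω (s + j) l) 0 :=
        (max_eq_left (X.queue_nonneg ω _ l)).symm
      rw [h2]
      nth_rewrite 2 [h3]
      refine (abs_max_sub_max_le_abs _ _ _).trans ?_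
      rw [add_sub_assoc, add_sub_cancel_left]
      exact h (s + j)
    have := abs_le.1 ih
    have := abs_le.1 h1
    push_cast
    exact abs_le.2 ⟨by linarith, by linarith⟩

theorem queue_le {a : ℝ} {l : Fin L} (h : ∀ t, |∑ n, X.z n t ω l - X.d t ω l| ≤ a) (t : ℕ) :
    X.queue ω t l ≤ a * t := by
  have h1 := X.abs_queue_sub_le h 0 t
  have h2 : X.queue ω 0 l = 0 := rfl
  rw [h2, zero_add, sub_zero] at h1
  exact (le_abs_self _).trans h1

/-- Truncation at `0` does not increase the square; expanding it leaves the squared increment, at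
most `a ^ 2`. -/
theorem queue_succ_sq_le {a : ℝ} {l : Fin L} {t : ℕ}
    (h : |∑ n, X.z n t ω l - X.d t ω l| ≤ a) :
    X.queue ω (t + 1) l ^ 2 ≤ X.queue ω t l ^ 2 +
      2 * (X.queue ω t l * (∑ n, X.z n t ω l - X.d t ω l)) + a ^ 2 := by
  have h1 : X.queue ω (t + 1) l ^ 2 ≤
      (X.queue ω t l + ∑ n, X.z n t ω l - X.d t ω l) ^ 2 := by
    have h2 : X.queue ω (t + 1) l =
      max (X.queue ω t l + ∑ n, X.z n t ω l - X.d t ω l) 0 := rfl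
    rw [h2]
    rcases le_total (X.queue ω t l + ∑ n, X.z n t ω l - X.d t ω l) 0 with h3 | h3
    · rw [max_eq_right h3]
      simpa using sq_nonneg _
    · rw [max_eq_left h3]
  have h4 := sq_le_sq' (abs_le.1 h).1 (abs_le.1 h).2
  nlinarith

namespace IsRunOf

variable {X} [∀ n, MeasurableSpace (A n)] [MeasurableSpace Ω] {P : Measure Ω}
  {κ : (n : Fin N) → Kernel (A n) (Frame L)} {ν : Measure (Fin L → ℝ)}
  {B ymax zmax dmax : ℝ}

theorem measurable_queue_apply (hX : X.IsRunOf P κ ν) (t : ℕ) (l : Fin L) :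
    Measurable fun ω => X.queue ω t l :=
  (measurable_pi_apply l).comp ((measurable_history_queue t).mono (hX.history_le t) le_rfl)

theorem measurable_d_apply (hX : X.IsRunOf P κ ν) (t : ℕ) (l : Fin L) :
    Measurable fun ω => X.d t ω l :=
  (measurable_pi_apply l).comp (hX.measurable_d t)

theorem integral_d (hX : X.IsRunOf P κ ν) (t : ℕ) (l : Fin L) :
    ∫ ω, X.d t ω l ∂P = ∫ x, x l ∂ν := by
  rw [← hX.law_d t, integral_map (hX.measurable_d t).aemeasurable
    (measurable_pi_apply l).aestronglyMeasurable]

theorem integral_queue_mul_d (hX : X.IsRunOf P κ ν) (t : ℕ) (l : Fin L) :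
    ∫ ω, X.queue ω t l * X.d t ω l ∂P = (∫ ω, X.queue ω t l ∂P) * ∫ x, x l ∂ν := by
  rw [← hX.integral_d t l]
  have h : IndepFun (fun ω => X.queue ω t l) (fun ω => X.d t ω l) P := by
    rw [IndepFun_iff_Indep]
    refine indep_of_indep_of_le_left (indep_of_indep_of_le_right (hX.indep_d t).symm ?_) ?_
    · exact ((measurable_pi_apply l).comp (comap_measurable (X.d t))).comap_le
    · exact ((measurable_pi_apply l).comp (measurable_history_queue t)).comap_le
  exact h.integral_fun_mul_eq_mul_integral (hX.measurable_queue_apply t l).aestronglyMeasurable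
    (hX.measurable_d_apply t l).aestronglyMeasurable

variable [IsProbabilityMeasure P]

theorem integrable_d (hX : X.IsRunOf P κ ν) (hd : ∀ᵐ x ∂ν, ∀ l, |x l| ≤ dmax)
    (t : ℕ) (l : Fin L) : Integrable (fun ω => X.d t ω l) P :=
  Integrable.of_bound (hX.measurable_d_apply t l).aestronglyMeasurable dmax
    ((hX.ae_forall_external hd).mono fun _ h => h t l)

variable [∀ n, IsMarkovKernel (κ n)]

theorem ae_abs_increment_le (hX : X.IsRunOf P κ ν)
    (hyz : ∀ n a, ∀ᵐ o ∂(κ n a), ∀ j, |(o.2 j).1| ≤ ymax ∧ ∀ l, |(o.2 j).2 l| ≤ zmax)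
    (hd : ∀ᵐ x ∂ν, ∀ l, |x l| ≤ dmax) :
    ∀ᵐ ω ∂P, ∀ l t, |∑ n, X.z n t ω l - X.d t ω l| ≤ N * zmax + dmax := by
  filter_upwards [hX.ae_bounds hyz, hX.ae_forall_external hd] with ω h1 h2 l t
  refine (abs_sub _ _).trans (add_le_add ?_ (h2 t l))
  refine (Finset.abs_sum_le_sum_abs _ _).trans
    ((Finset.sum_le_sum fun n _ => (h1 n t).2 l).trans ?_)
  simp

section Integrability

variable (hX : X.IsRunOf P κ ν)
  (hyz : ∀ n a, ∀ᵐ o ∂(κ n a), ∀ j, |(o.2 j).1| ≤ ymax ∧ ∀ l, |(o.2 j).2 l| ≤ zmax)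
  (hd : ∀ᵐ x ∂ν, ∀ l, |x l| ≤ dmax)
include hX hyz hd

theorem ae_abs_queue_le (t : ℕ) (l : Fin L) :
    ∀ᵐ ω ∂P, |X.queue ω t l| ≤ (N * zmax + dmax) * t := by
  filter_upwards [hX.ae_abs_increment_le hyz hd] with ω h
  rw [abs_of_nonneg (X.queue_nonneg ω t l)]
  exact X.queue_le (h l) t

theorem integrable_queue_mul {f : Ω → ℝ} (hf : Integrable f P) (t : ℕ) (l : Fin L) :
    Integrable (fun ω => X.queue ω t l * f ω) P :=
  hf.bdd_mul (hX.measurable_queue_apply t l).aestronglyMeasurable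
    (hX.ae_abs_queue_le hyz hd t l)

theorem integrable_queue (t : ℕ) (l : Fin L) : Integrable (fun ω => X.queue ω t l) P :=
  Integrable.of_bound (hX.measurable_queue_apply t l).aestronglyMeasurable _
    (hX.ae_abs_queue_le hyz hd t l)

theorem integrable_queue_sq (t : ℕ) (l : Fin L) : Integrable (fun ω => X.queue ω t l ^ 2) P := by
  simp only [sq]
  exact hX.integrable_queue_mul hyz hd (hX.integrable_queue hyz hd t l) t l

end Integrability

/-- Performance of one system under the algorithm, relative to a stationary benchmark. -/
theorem sum_integral_dpp_le (hX : X.IsRunOf P κ ν) (hB : 0 ≤ B) (hy0 : 0 ≤ ymax)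
    (hz0 : 0 ≤ zmax) (hd0 : 0 ≤ dmax) (hres : ∀ n a, Frame.ResidualBound B (κ n a))
    (hyz : ∀ n a, ∀ᵐ o ∂(κ n a), ∀ j, |(o.2 j).1| ≤ ymax ∧ ∀ l, |(o.2 j).2 l| ≤ zmax)
    (hd : ∀ᵐ x ∂ν, ∀ l, |x l| ≤ dmax) {V : ℝ} (hV : 0 < V) (halg : X.FollowsAlgorithm P κ V)
    (n : Fin N) {f : ℝ} {g : Fin L → ℝ} (hf : |f| ≤ ymax) (hg : ∀ l, |g l| ≤ zmax)
    (hfg : ∀ c (q : Fin L → ℝ), (∀ a, c ≤ dppRatio (κ n) V q a) → c ≤ V * f + ∑ l, q l * g l)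
    (T : ℕ) :
    ∑ t ∈ range T, ∫ ω, (V * (X.y n t ω - f) +
        ∑ l, X.queue ω t l * (X.z n t ω l - g l)) ∂P ≤
      2 * V * ymax * B + 3 * L * zmax * (N * zmax + dmax) * B * T := by
  set a : ℝ := N * zmax + dmax with ha
  have ha0 : 0 ≤ a := by positivity
  have hinc := hX.ae_abs_increment_le hyz hd
  have hsum : ∀ᵐ ω ∂P, ∀ t l, |X.z n t ω l - g l| ≤ 2 * zmax := by
    filter_upwards [hX.ae_bounds hyz] with ω h t l
    refine (abs_sub _ _).trans ?_
    linarith [(h n t).2 l, hg l]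
  -- `M` uses that the queue before `T` is at most `a * T`. Overshoot thus contributes `2` and drift
  -- within frames `1` to the factor `3` in the conclusion.
  have h := hX.integral_sum_le hB (hres n) (hyz n) V
    (R := fun s ω => (X.queue ω s, V * f + ∑ l, X.queue ω s l * g l))
    (M := 2 * V * ymax + 2 * L * zmax * a * T) (K := L * zmax * a) (T := T)
    (by positivity) (by positivity) ?_ ?_ ?_
    (φ := fun t ω => V * (X.y n t ω - f) + ∑ l, X.queue ω t l * (X.z n t ω l - g l)) ?_ ?_
  · refine h.trans (le_of_eq ?_)
    ring
  · intro s
    have h1 := measurable_history_queue (X := X) s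
    refine h1.prodMk (measurable_const.add (Finset.measurable_sum _ fun l _ => ?_))
    exact ((measurable_pi_apply l).comp h1).mul_const _
  · filter_upwards [hX.ae_bounds hyz, hinc, hsum] with ω hω hq hz s hs t
    have h1 : V * X.y n t ω + ∑ l, X.queue ω s l * X.z n t ω l -
        (V * f + ∑ l, X.queue ω s l * g l) =
        V * (X.y n t ω - f) + ∑ l, X.queue ω s l * (X.z n t ω l - g l) := by
      simp only [mul_sub, Finset.sum_sub_distrib]
      ring
    simp only [h1]
    have h2 : |V * (X.y n t ω - f)| ≤ 2 * V * ymax := by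
      rw [abs_mul, abs_of_pos hV]
      have h3 : |X.y n t ω - f| ≤ 2 * ymax := by
        refine (abs_sub _ _).trans ?_
        linarith [(hω n t).1]
      nlinarith
    have h4 : |∑ l, X.queue ω s l * (X.z n t ω l - g l)| ≤ 2 * L * zmax * a * T := by
      refine (Finset.abs_sum_le_sum_abs _ _).trans
        ((Finset.sum_le_sum (g := fun _ => a * T * (2 * zmax)) fun l _ => ?_).trans ?_)
      · rw [abs_mul, abs_of_nonneg (X.queue_nonneg ω s l)]
        have h5 : (s : ℝ) ≤ T := by exact_mod_cast hs.le
        exact mul_le_mul ((X.queue_le (hq l) s).trans (mul_le_mul_of_nonneg_left h5 ha0))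
          (hz t l) (abs_nonneg _) (by positivity)
      · simp only [sum_const, card_univ, Fintype.card_fin, nsmul_eq_mul]
        exact le_of_eq (by ring)
    exact (abs_add_le _ _).trans (add_le_add h2 h4)
  · filter_upwards [ae_all_iff.2 (halg n)] with ω hω k s hs
    have h1 := hω k
    rw [hs] at h1
    -- Here `c` is the ratio of the chosen action itself, which by minimality lies below all others.
    exact hfg _ _ h1
  · intro t _
    refine (((hX.integrable_y hyz n t).sub (integrable_const f)).const_mul V).add
      (integrable_finsetSum _ fun l _ => ?_)
    exact hX.integrable_queue_mul hyz hd
      ((hX.integrable_z hyz n t l).sub (integrable_const (g l))) t l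
  · filter_upwards [hinc, hsum] with ω hq hz s j _
    have h1 : ∑ l, X.queue ω (s + j) l * (X.z n (s + j) ω l - g l) ≤
        ∑ l, (X.queue ω s l * X.z n (s + j) ω l - X.queue ω s l * g l +
          a * j * (2 * zmax)) := by
      refine Finset.sum_le_sum fun l _ => ?_
      -- The price of using the queue from the start of the frame: drift `a * j` times deviation `2
      -- * zmax`. Summed over `l` this is `K * (2 * j)`, within the allowance `K * (2 * j + 1)`.
      have h2 : (X.queue ω (s + j) l - X.queue ω s l) * (X.z n (s + j) ω l - g l) ≤
          a * j * (2 * zmax) := by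
        refine (le_abs_self _).trans ?_
        rw [abs_mul]
        exact mul_le_mul (X.abs_queue_sub_le (hq l) s j) (hz _ l) (abs_nonneg _) (by positivity)
      linarith
    simp only [Finset.sum_add_distrib, Finset.sum_sub_distrib, sum_const, card_univ,
      Fintype.card_fin, nsmul_eq_mul] at h1
    have h3 : (0 : ℝ) ≤ L * zmax * a := by positivity
    simp only [mul_sub, Finset.sum_sub_distrib] at h1 ⊢
    linarith

/-- The drift-plus-penalty bound for all systems together. -/
theorem drift_plus_penalty_le (hX : X.IsRunOf P κ ν) (hB : 0 ≤ B) (hy0 : 0 ≤ ymax)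
    (hz0 : 0 ≤ zmax) (hd0 : 0 ≤ dmax) (hres : ∀ n a, Frame.ResidualBound B (κ n a))
    (hyz : ∀ n a, ∀ᵐ o ∂(κ n a), ∀ j, |(o.2 j).1| ≤ ymax ∧ ∀ l, |(o.2 j).2 l| ≤ zmax)
    (hd : ∀ᵐ x ∂ν, ∀ l, |x l| ≤ dmax) {V : ℝ} (hV : 0 < V) (halg : X.FollowsAlgorithm P κ V)
    {f : Fin N → ℝ} {g : Fin N → Fin L → ℝ} (hf : ∀ n, |f n| ≤ ymax) (hg : ∀ n l, |g n l| ≤ zmax)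
    (hgd : ∀ l, ∑ n, g n l ≤ ∫ x, x l ∂ν)
    (hfg : ∀ n c (q : Fin L → ℝ), (∀ a, c ≤ dppRatio (κ n) V q a) →
      c ≤ V * f n + ∑ l, q l * g n l) (T : ℕ) :
    (∑ l, ∫ ω, X.queue ω T l ^ 2 ∂P) / 2 +
        V * (∑ t ∈ range T, ∑ n, ∫ ω, X.y n t ω ∂P - T * ∑ n, f n) ≤
      2 * N * V * ymax * B + (N * (3 * L * zmax * (N * zmax + dmax) * B) +
        (N * zmax + dmax) ^ 2 * L / 2) * T := by
  set a : ℝ := N * zmax + dmax with ha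
  have hyi := hX.integrable_y hyz
  have hzi := hX.integrable_z hyz
  have hdi := hX.integrable_d hd
  have hqi := hX.integrable_queue hyz hd
  have hq2 := hX.integrable_queue_sq hyz hd
  have hqz := fun n t l => hX.integrable_queue_mul hyz hd (hzi n t l) t l
  have hqd := fun t l => hX.integrable_queue_mul hyz hd (hdi t l) t l
  have hdpp : ∀ n t, ∫ ω, (V * (X.y n t ω - f n) +
      ∑ l, X.queue ω t l * (X.z n t ω l - g n l)) ∂P =
      V * (∫ ω, X.y n t ω ∂P - f n) + ∑ l, (∫ ω, X.queue ω t l * X.z n t ω l ∂P -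
        (∫ ω, X.queue ω t l ∂P) * g n l) := by
    intro n t
    have h1 : Integrable (fun ω => V * (X.y n t ω - f n)) P :=
      ((hyi n t).sub (integrable_const _)).const_mul V
    have h2 : ∀ l, Integrable (fun ω => X.queue ω t l * (X.z n t ω l - g n l)) P := fun l =>
      hX.integrable_queue_mul hyz hd ((hzi n t l).sub (integrable_const _)) t l
    rw [integral_add h1 (integrable_finsetSum _ fun l _ => h2 l), integral_const_mul,
      integral_sub (hyi n t) (integrable_const _), integral_finsetSum _ fun l _ => h2 l]
    simp only [mul_sub, integral_const, probReal_univ, one_smul]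
    congr 1
    refine Finset.sum_congr rfl fun l _ => ?_
    rw [integral_sub (hqz n t l) ((hqi t l).mul_const _), integral_mul_const]
  have hdrift : ∀ t l, ∫ ω, X.queue ω (t + 1) l ^ 2 ∂P ≤ ∫ ω, X.queue ω t l ^ 2 ∂P +
      2 * ∑ n, (∫ ω, X.queue ω t l * X.z n t ω l ∂P - (∫ ω, X.queue ω t l ∂P) * g n l) +
        a ^ 2 := by
    intro t l
    have h1 : Integrable (fun ω => X.queue ω t l * (∑ n, X.z n t ω l - X.d t ω l)) P :=
      hX.integrable_queue_mul hyz hd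
        ((integrable_finsetSum _ fun n _ => hzi n t l).sub (hdi t l)) t l
    have h2 := integral_mono_ae (hq2 (t + 1) l)
      (((hq2 t l).add (h1.const_mul 2)).add (integrable_const (a ^ 2)))
      ((hX.ae_abs_increment_le hyz hd).mono fun ω h => X.queue_succ_sq_le (h l t))
    have h3 : ∫ ω, (X.queue ω t l ^ 2 +
        2 * (X.queue ω t l * (∑ n, X.z n t ω l - X.d t ω l)) + a ^ 2) ∂P =
        ∫ ω, X.queue ω t l ^ 2 ∂P +
        2 * (∑ n, ∫ ω, X.queue ω t l * X.z n t ω l ∂P -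
          (∫ ω, X.queue ω t l ∂P) * ∫ x, x l ∂ν) + a ^ 2 := by
      have h4 : Integrable (fun ω => X.queue ω t l ^ 2 +
        2 * (X.queue ω t l * (∑ n, X.z n t ω l - X.d t ω l))) P :=
        (hq2 t l).add (h1.const_mul 2)
      rw [integral_add h4 (integrable_const _), integral_add (hq2 t l) (h1.const_mul 2),
        integral_const_mul]
      simp only [mul_sub, Finset.mul_sum, integral_const, probReal_univ, one_smul]
      rw [integral_sub (integrable_finsetSum _ fun n _ => hqz n t l) (hqd t l),
        integral_finsetSum _ fun n _ => hqz n t l, hX.integral_queue_mul_d, mul_sub,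
        Finset.mul_sum]
    refine h2.trans ((le_of_eq h3).trans ?_)
    -- Feasibility of the benchmark enters here: queues are nonnegative, so the mean of `d` may be
    -- replaced by the smaller `∑ n, g n l`.
    have h5 : (∫ ω, X.queue ω t l ∂P) * ∑ n, g n l ≤ (∫ ω, X.queue ω t l ∂P) * ∫ x, x l ∂ν :=
      mul_le_mul_of_nonneg_left (hgd l) (integral_nonneg fun ω => X.queue_nonneg ω t l)
    rw [Finset.sum_sub_distrib, ← Finset.mul_sum]
    linarith
  have htel : ∀ T : ℕ, (∑ l, ∫ ω, X.queue ω T l ^ 2 ∂P) / 2 +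
      V * (∑ t ∈ range T, ∑ n, ∫ ω, X.y n t ω ∂P - T * ∑ n, f n) ≤
      ∑ t ∈ range T, ∑ n, ∫ ω, (V * (X.y n t ω - f n) +
        ∑ l, X.queue ω t l * (X.z n t ω l - g n l)) ∂P + a ^ 2 * L / 2 * T := by
    intro T
    induction T with
    | zero => simp [queue]
    | succ T ih =>
      rw [Finset.sum_range_succ, Finset.sum_range_succ]
      have h1 := Finset.sum_le_sum fun l (_ : l ∈ Finset.univ) => hdrift T l
      simp only [Finset.sum_add_distrib, ← Finset.mul_sum, sum_const, card_univ,
        Fintype.card_fin, nsmul_eq_mul] at h1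
      rw [Finset.sum_comm] at h1
      have h2 : ∑ n, ∫ ω, (V * (X.y n T ω - f n) +
          ∑ l, X.queue ω T l * (X.z n T ω l - g n l)) ∂P =
          V * (∑ n, ∫ ω, X.y n T ω ∂P - ∑ n, f n) +
          ∑ n, ∑ l, (∫ ω, X.queue ω T l * X.z n T ω l ∂P -
            (∫ ω, X.queue ω T l ∂P) * g n l) := by
        simp only [hdpp]
        rw [Finset.sum_add_distrib, ← Finset.mul_sum, Finset.sum_sub_distrib]
      rw [h2]
      push_cast
      linarith
  refine (htel T).trans ?_
  rw [Finset.sum_comm]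
  have h1 := Finset.sum_le_sum fun n (_ : n ∈ Finset.univ) =>
    hX.sum_integral_dpp_le hB hy0 hz0 hd0 hres hyz hd hV halg n (hf n) (hg n) (hfg n) T
  simp only [sum_const, card_univ, Fintype.card_fin, nsmul_eq_mul] at h1
  refine (add_le_add_left h1 _).trans (le_of_eq ?_)
  ring

end IsRunOf

end Run

/-! ### From the drift bound to long-run averages -/

/-- The bounds on metrics and on the external process may be taken nonnegative without changing
the constants of the main theorem. -/
theorem exists_nonneg_bounds {N L : ℕ} {A : Fin N → Type u} [∀ n, MeasurableSpace (A n)]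
    {κ : (n : Fin N) → Kernel (A n) (Frame L)} [∀ n, IsMarkovKernel (κ n)]
    {ν : Measure (Fin L → ℝ)} [IsProbabilityMeasure ν] (hA : ∀ n, Nonempty (A n))
    {ymax zmax dmax : ℝ}
    (hyz : ∀ n a, ∀ᵐ o ∂(κ n a), ∀ j, |(o.2 j).1| ≤ ymax ∧ ∀ l, |(o.2 j).2 l| ≤ zmax)
    (hd : ∀ᵐ x ∂ν, ∀ l, |x l| ≤ dmax) :
    ∃ z₀ d₀ : ℝ, 0 ≤ z₀ ∧ 0 ≤ d₀ ∧
      (∀ n a, ∀ᵐ o ∂(κ n a), ∀ j, |(o.2 j).1| ≤ |ymax| ∧ ∀ l, |(o.2 j).2 l| ≤ z₀) ∧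
      (∀ᵐ x ∂ν, ∀ l, |x l| ≤ d₀) ∧
      (N : ℝ) * L * zmax = N * L * z₀ ∧ (L : ℝ) * (N * zmax + dmax) = L * (N * z₀ + d₀) := by
  have hy' : ∀ n a, ∀ᵐ o ∂(κ n a), ∀ j, |(o.2 j).1| ≤ |ymax| ∧ ∀ l, |(o.2 j).2 l| ≤ zmax :=
    fun n a => (hyz n a).mono fun o h j => ⟨(h j).1.trans (le_abs_self _), (h j).2⟩
  -- A negative bound can occur only when it constrains nothing, that is for `L = 0` or, for
  -- metrics, `N = 0`; the constants then do not see it.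
  rcases Nat.eq_zero_or_pos L with rfl | hL
  · exact ⟨0, 0, le_rfl, le_rfl,
      fun n a => (hy' n a).mono fun o h j => ⟨(h j).1, fun l => l.elim0⟩,
      ae_of_all _ fun x l => l.elim0, by simp, by simp⟩
  · have hd0 : 0 ≤ dmax := by
      obtain ⟨x, hx⟩ := hd.exists
      exact (abs_nonneg _).trans (hx ⟨0, hL⟩)
    rcases Nat.eq_zero_or_pos N with rfl | hN
    · exact ⟨0, dmax, le_rfl, hd0, fun n => n.elim0, hd, by simp, by simp⟩
    · refine ⟨zmax, dmax, ?_, hd0, hy', hd, rfl, rfl⟩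
      obtain ⟨a⟩ := hA ⟨0, hN⟩
      obtain ⟨o, ho⟩ := (hyz ⟨0, hN⟩ a).exists
      exact (abs_nonneg _).trans ((ho ⟨0, o.1.pos⟩).2 ⟨0, hL⟩)

/-- Integrate `2 √T Q ≤ T + Q²`, in place of Cauchy–Schwarz. -/
theorem mul_le_div_sqrt_of_sq_le {Ω : Type*} [MeasurableSpace Ω] {P : Measure Ω}
    [IsProbabilityMeasure P] {Q : Ω → ℝ} (hQ : Integrable Q P)
    (hQ2 : Integrable (fun ω => Q ω ^ 2) P) {K T : ℝ} (hT : 0 < T)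
    (h : ∫ ω, Q ω ^ 2 ∂P ≤ K * T) : 1 / T * ∫ ω, Q ω ∂P ≤ (1 + K) / 2 / √T := by
  have hr : 0 < √T := Real.sqrt_pos.2 hT
  have hrT : √T * √T = T := Real.mul_self_sqrt hT.le
  have h1 : ∫ ω, 2 * √T * Q ω ∂P ≤ ∫ ω, (T + Q ω ^ 2) ∂P := by
    refine integral_mono (hQ.const_mul _) ((integrable_const T).add hQ2) fun ω => ?_
    nlinarith [sq_nonneg (√T - Q ω)]
  rw [integral_const_mul, integral_add (integrable_const T) hQ2] at h1
  simp only [integral_const, probReal_univ, one_smul] at h1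
  rw [one_div, inv_mul_le_iff₀ hT, mul_div_assoc', le_div_iff₀ hr]
  linarith

open Topology in
theorem limsup_average_le_of_integral_sq_le {Ω : Type*} [MeasurableSpace Ω] {P : Measure Ω}
    [IsProbabilityMeasure P] {Q : ℕ → Ω → ℝ} (hQ : ∀ T, Integrable (Q T) P)
    (hQ2 : ∀ T, Integrable (fun ω => Q T ω ^ 2) P) {K b c : ℝ}
    (h : ∀ T : ℕ, 0 < T → ∫ ω, Q T ω ^ 2 ∂P ≤ K * T) {x : ℕ → ℝ}
    (hx : ∀ T, ∑ t ∈ range T, (x t - c) ≤ ∫ ω, Q T ω ∂P)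
    (hb : ∀ T : ℕ, b ≤ 1 / (T : ℝ) * ∑ t ∈ range T, x t) :
    limsup (fun T : ℕ => 1 / (T : ℝ) * ∑ t ∈ range T, x t) atTop ≤ c := by
  have hlim : Tendsto (fun T : ℕ => c + (1 + K) / 2 / √(T : ℝ)) atTop (𝓝 (c + 0)) :=
    tendsto_const_nhds.add (tendsto_const_nhds.div_atTop
      (Real.tendsto_sqrt_atTop.comp tendsto_natCast_atTop_atTop))
  rw [add_zero] at hlim
  refine limsup_le_of_eventuallyLE_of_tendsto hb ?_ hlim
  filter_upwards [eventually_gt_atTop 0] with T hT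
  have hT' : (0 : ℝ) < T := by exact_mod_cast hT
  have h1 := mul_le_div_sqrt_of_sq_le (hQ T) (hQ2 T) hT' (h T hT)
  have h2 := mul_le_mul_of_nonneg_left (hx T) (by positivity : 0 ≤ 1 / (T : ℝ))
  have h3 : 1 / (T : ℝ) * ∑ t ∈ range T, (x t - c) = 1 / (T : ℝ) * ∑ t ∈ range T, x t - c := by
    rw [Finset.sum_sub_distrib]
    simp only [sum_const, card_range, nsmul_eq_mul]
    field_simp
  linarith

namespace Run.IsRunOf

variable {N : ℕ} {A : Fin N → Type u} {L : ℕ} {Ω : Type v} {X : Run A L Ω}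
  [∀ n, MeasurableSpace (A n)] [MeasurableSpace Ω] {P : Measure Ω}
  {κ : (n : Fin N) → Kernel (A n) (Frame L)} {ν : Measure (Fin L → ℝ)}
  [IsProbabilityMeasure P] [∀ n, IsMarkovKernel (κ n)] {B ymax zmax dmax V : ℝ}

theorem abs_sum_integral_y_le (hX : X.IsRunOf P κ ν)
    (hyz : ∀ n a, ∀ᵐ o ∂(κ n a), ∀ j, |(o.2 j).1| ≤ ymax ∧ ∀ l, |(o.2 j).2 l| ≤ zmax)
    (t : ℕ) : |∑ n, ∫ ω, X.y n t ω ∂P| ≤ N * ymax := by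
  refine (Finset.abs_sum_le_sum_abs _ _).trans
    ((Finset.sum_le_sum fun n _ => hX.abs_integral_y_le hyz n t).trans ?_)
  simp

theorem abs_sum_integral_z_le (hX : X.IsRunOf P κ ν)
    (hyz : ∀ n a, ∀ᵐ o ∂(κ n a), ∀ j, |(o.2 j).1| ≤ ymax ∧ ∀ l, |(o.2 j).2 l| ≤ zmax)
    (t : ℕ) (l : Fin L) : |∑ n, ∫ ω, X.z n t ω l ∂P| ≤ N * zmax := by
  refine (Finset.abs_sum_le_sum_abs _ _).trans
    ((Finset.sum_le_sum fun n _ => hX.abs_integral_z_le hyz n t l).trans ?_)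
  simp

variable {f : Fin N → ℝ} {g : Fin N → Fin L → ℝ}

/-- The penalty term in the drift bound is at least a negative multiple of `T`, so `E Q²` grows at
most linearly and the queues are mean rate stable. -/
theorem satisfiesConstraints_of_benchmark (hX : X.IsRunOf P κ ν) (hB : 0 ≤ B) (hy0 : 0 ≤ ymax)
    (hz0 : 0 ≤ zmax) (hd0 : 0 ≤ dmax) (hres : ∀ n a, Frame.ResidualBound B (κ n a))
    (hyz : ∀ n a, ∀ᵐ o ∂(κ n a), ∀ j, |(o.2 j).1| ≤ ymax ∧ ∀ l, |(o.2 j).2 l| ≤ zmax)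
    (hd : ∀ᵐ x ∂ν, ∀ l, |x l| ≤ dmax) (hV : 0 < V) (halg : X.FollowsAlgorithm P κ V)
    (hf : ∀ n, |f n| ≤ ymax) (hg : ∀ n l, |g n l| ≤ zmax)
    (hgd : ∀ l, ∑ n, g n l ≤ ∫ x, x l ∂ν)
    (hfg : ∀ n c (q : Fin L → ℝ), (∀ a, c ≤ dppRatio (κ n) V q a) →
      c ≤ V * f n + ∑ l, q l * g n l) :
    X.SatisfiesConstraints P ν := by
  intro l
  have hq2 := hX.integrable_queue_sq hyz hd
  set C : ℝ := 2 * N * V * ymax * B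
  set D : ℝ := N * (3 * L * zmax * (N * zmax + dmax) * B) + (N * zmax + dmax) ^ 2 * L / 2
  have hC : 0 ≤ C := by positivity
  -- In `K`, the summand `C` uses `C ≤ C * T` for `T ≥ 1`, and `2 * (N * ymax)` bounds the gap per
  -- slot between the penalty and the benchmark.
  refine limsup_average_le_of_integral_sq_le (Q := fun T ω => X.queue ω T l)
    (K := 2 * (C + D + V * (2 * (N * ymax)))) (b := -(N * zmax))
    (fun T => hX.integrable_queue hyz hd T l) (fun T => hq2 T l) (fun T hT => ?_) (fun T => ?_)
    (fun T => (abs_le.1 (abs_average_le (by positivity)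
      (fun t => hX.abs_sum_integral_z_le hyz t l) T)).1)
  · have h1 := hX.drift_plus_penalty_le hB hy0 hz0 hd0 hres hyz hd hV halg hf hg hgd hfg T
    have hT1 : (1 : ℝ) ≤ T := by exact_mod_cast hT
    have h2 : ∫ ω, X.queue ω T l ^ 2 ∂P ≤ ∑ l, ∫ ω, X.queue ω T l ^ 2 ∂P :=
      Finset.single_le_sum (f := fun l => ∫ ω, X.queue ω T l ^ 2 ∂P)
        (fun l _ => integral_nonneg fun ω => sq_nonneg _) (Finset.mem_univ l)
    have h3 : -(T * (N * ymax)) ≤ ∑ t ∈ range T, ∑ n, ∫ ω, X.y n t ω ∂P := by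
      have h := Finset.sum_le_sum fun t (_ : t ∈ range T) =>
        (abs_le.1 (hX.abs_sum_integral_y_le hyz t)).1
      simpa using h
    have h4 : ∑ n, f n ≤ N * ymax := by
      have h := Finset.sum_le_sum fun n (_ : n ∈ Finset.univ) => (abs_le.1 (hf n)).2
      simpa using h
    have h5 : V * (-(2 * (N * ymax)) * T) ≤
        V * (∑ t ∈ range T, ∑ n, ∫ ω, X.y n t ω ∂P - T * ∑ n, f n) := by
      refine mul_le_mul_of_nonneg_left ?_ hV.le
      nlinarith
    have h6 : C ≤ C * T := le_mul_of_one_le_right hC hT1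
    change (∑ l, ∫ ω, X.queue ω T l ^ 2 ∂P) / 2 + _ ≤ C + D * T at h1
    linarith
  · have hi : ∀ t, Integrable (fun ω => ∑ n, X.z n t ω l) P := fun t =>
      integrable_finsetSum _ fun n _ => hX.integrable_z hyz n t l
    have h1 : ∀ t, ∑ n, ∫ ω, X.z n t ω l ∂P - ∫ x, x l ∂ν =
        ∫ ω, (∑ n, X.z n t ω l - X.d t ω l) ∂P := by
      intro t
      rw [integral_sub (hi t) (hX.integrable_d hd t l),
        integral_finsetSum _ fun n _ => hX.integrable_z hyz n t l, hX.integral_d]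
    simp only [h1]
    have hi' : ∀ t, Integrable (fun ω => ∑ n, X.z n t ω l - X.d t ω l) P := fun t =>
      (hi t).sub (hX.integrable_d hd t l)
    rw [← integral_finsetSum _ fun t _ => hi' t]
    exact integral_mono (integrable_finsetSum _ fun t _ => hi' t)
      (hX.integrable_queue hyz hd T l) fun ω => X.sum_le_queue ω T l

open Topology in
theorem longRunPenalty_le_of_benchmark (hX : X.IsRunOf P κ ν) (hB : 0 ≤ B) (hy0 : 0 ≤ ymax)
    (hz0 : 0 ≤ zmax) (hd0 : 0 ≤ dmax) (hres : ∀ n a, Frame.ResidualBound B (κ n a))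
    (hyz : ∀ n a, ∀ᵐ o ∂(κ n a), ∀ j, |(o.2 j).1| ≤ ymax ∧ ∀ l, |(o.2 j).2 l| ≤ zmax)
    (hd : ∀ᵐ x ∂ν, ∀ l, |x l| ≤ dmax) (hV : 0 < V) (halg : X.FollowsAlgorithm P κ V)
    (hf : ∀ n, |f n| ≤ ymax) (hg : ∀ n l, |g n l| ≤ zmax)
    (hgd : ∀ l, ∑ n, g n l ≤ ∫ x, x l ∂ν)
    (hfg : ∀ n c (q : Fin L → ℝ), (∀ a, c ≤ dppRatio (κ n) V q a) →
      c ≤ V * f n + ∑ l, q l * g n l) :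
    X.longRunPenalty P ≤ ∑ n, f n + (N * (3 * L * zmax * (N * zmax + dmax) * B) +
      (N * zmax + dmax) ^ 2 * L / 2) / V := by
  set C : ℝ := 2 * N * V * ymax * B
  set D : ℝ := N * (3 * L * zmax * (N * zmax + dmax) * B) + (N * zmax + dmax) ^ 2 * L / 2
  have hlim : Tendsto (fun T : ℕ => ∑ n, f n + D / V + C / V / T) atTop
      (𝓝 (∑ n, f n + D / V + 0)) :=
    tendsto_const_nhds.add (tendsto_const_div_atTop_nhds_zero_nat _)
  rw [add_zero] at hlim
  refine limsup_le_of_eventuallyLE_of_tendsto (b := -(N * ymax)) (fun T =>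
    (abs_le.1 (abs_average_le (by positivity) (hX.abs_sum_integral_y_le hyz) T)).1) ?_ hlim
  filter_upwards [eventually_gt_atTop 0] with T hT
  have hT' : (0 : ℝ) < T := by exact_mod_cast hT
  have h1 := hX.drift_plus_penalty_le hB hy0 hz0 hd0 hres hyz hd hV halg hf hg hgd hfg T
  change (∑ l, ∫ ω, X.queue ω T l ^ 2 ∂P) / 2 + _ ≤ C + D * T at h1
  have h2 : 0 ≤ ∑ l, ∫ ω, X.queue ω T l ^ 2 ∂P :=
    Finset.sum_nonneg fun l _ => integral_nonneg fun ω => sq_nonneg _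
  have h3 : V * (∑ t ∈ range T, ∑ n, ∫ ω, X.y n t ω ∂P - T * ∑ n, f n) ≤ C + D * T := by
    linarith
  rw [one_div, inv_mul_le_iff₀ hT']
  have h4 : (T : ℝ) * (∑ n, f n + D / V + C / V / T) = T * ∑ n, f n + (C + D * T) / V := by
    field_simp
    ring
  rw [h4]
  have h5 := (le_div_iff₀' hV).2 h3
  linarith

end Run.IsRunOf

theorem mainTheorem1 {N L : ℕ} {A : Fin N → Type u} [∀ n, MeasurableSpace (A n)]
    -- the frame laws of the systems and the law of the external process
    (κ : (n : Fin N) → Kernel (A n) (Frame L)) [∀ n, IsMarkovKernel (κ n)]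
    (ν : Measure (Fin L → ℝ)) [IsProbabilityMeasure ν]
    -- feasibility
    (hfeas : (feasibleValues κ ν).Nonempty)
    -- boundedness
    (ymax zmax dmax B : ℝ)
    (hyz : ∀ n a, ∀ᵐ o ∂(κ n a), ∀ j, |(o.2 j).1| ≤ ymax ∧ ∀ l, |(o.2 j).2 l| ≤ zmax)
    (hd : ∀ᵐ x ∂ν, ∀ l, |x l| ≤ dmax)
    (hB : 1 ≤ B)
    (hresidual : ∀ n a (s : ℕ), 0 < κ n a {o | s ≤ o.duration} →
      ∫⁻ o, ENNReal.ofReal (((o.duration : ℝ) - s) ^ 2) ∂((κ n a)[|{o | s ≤ o.duration}]) ≤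
        ENNReal.ofReal B)
    -- compactness of the sets of performance vectors
    (hcompact : ∀ n, IsCompact (Set.range (performanceVector (κ n))))
    -- a run under the proposed algorithm
    (V : ℝ) (hV : 0 < V)
    {Ω : Type v} [MeasurableSpace Ω] (P : Measure Ω) [IsProbabilityMeasure P]
    (X : Run A L Ω) (hX : X.IsRunOf P κ ν) (halg : X.FollowsAlgorithm P κ V) :
    X.SatisfiesConstraints P ν ∧
      X.longRunPenalty P ≤ optimalValue κ ν +
        ((N : ℝ) * (6 * L * zmax * (N * zmax + dmax) * B) +
          (N * zmax + dmax) ^ 2 * L / 2) / V := by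
  have hB0 : 0 ≤ B := by linarith
  have hA : ∀ n, Nonempty (A n) := fun n =>
    (nonempty_of_isProbabilityMeasure P).map fun ω => X.action n 0 ω
  obtain ⟨z₀, d₀, hz0, hd0, hyz', hd', hz, hzd⟩ := exists_nonneg_bounds hA hyz hd
  have hres : ∀ n a, Frame.ResidualBound B (κ n a) := hresidual
  have hconst : (N : ℝ) * (6 * L * zmax * (N * zmax + dmax) * B) +
      (N * zmax + dmax) ^ 2 * L / 2 =
      N * (6 * L * z₀ * (N * z₀ + d₀) * B) + (N * z₀ + d₀) ^ 2 * L / 2 := by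
    rcases Nat.eq_zero_or_pos L with rfl | hL
    · simp
    · have hL' : (L : ℝ) ≠ 0 := by positivity
      have h := mul_left_cancel₀ hL' hzd
      rw [h]
      linear_combination 6 * (N * z₀ + d₀) * B * hz
  -- Each feasible run supplies its own benchmark, so no optimal policy has to exist: the infimum is
  -- taken only at the end.
  have key : ∀ r ∈ feasibleValues κ ν, X.SatisfiesConstraints P ν ∧
      X.longRunPenalty P ≤ r + (N * (6 * L * z₀ * (N * z₀ + d₀) * B) +
        (N * z₀ + d₀) ^ 2 * L / 2) / V := by
    rintro r ⟨Ω', _, P', X', hP', hX', hcon, rfl⟩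
    obtain ⟨f, g, hf, hg, hfr, hgr, hfg⟩ :=
      hX'.exists_benchmark hB0 (abs_nonneg ymax) hz0 hres hyz'
    have hgd : ∀ l, ∑ n, g n l ≤ ∫ x, x l ∂ν := fun l => (hgr l).trans (hcon l)
    refine ⟨hX.satisfiesConstraints_of_benchmark hB0 (abs_nonneg ymax) hz0 hd0 hres hyz' hd' hV
      halg hf hg hgd fun n => hfg n V, ?_⟩
    refine (hX.longRunPenalty_le_of_benchmark hB0 (abs_nonneg ymax) hz0 hd0 hres hyz' hd' hV
      halg hf hg hgd fun n => hfg n V).trans ?_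
    -- The argument yields `3` where the stated constant has `6`.
    gcongr
    norm_num
  refine ⟨(key _ hfeas.some_mem).1, ?_⟩
  rw [hconst, ← sub_le_iff_le_add]
  exact le_csInf hfeas fun r hr => sub_le_iff_le_add.2 (key r hr).2
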